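/- There are universal constants $c_0, c', c_1, c_2 > 0$ such that the following holds. Let $n \ge 1$, let $M \in \mathbb{R}^{n\times n}$ be a matrix of rank $r$, and let $0 < p \le 1$ satisfy $p \ge c_0 \frac{\log n}{n}$. Let $\Omega \subseteq \{1,\dots,n\}^2$ be a random set containing each pair $(i,j)$ with probability $p$, independently of all other pairs, and let $\mathcal{P}_\Omega M$ be the matrix obtained from $M$ by setting the entries outside $\Omega$ to zero. Let $\widetilde M^\Omega$ be obtained from $\mathcal{P}_\Omega M$ by setting to zero all rows and all columns of $\mathcal{P}_\Omega M$ that have more than $2pn$ non-zero entries. For a singular value decomposition $\widetilde M^\Omega = \sum_{i=1}^n \tilde\sigma_i \tilde u_i \tilde v_i^\top$ with $\tilde\sigma_1 \ge \dots \ge \tilde\sigma_n \ge 0$ and orthonormal bases $(\tilde u_i)$, $(\tilde v_i)$ of $\mathbb{R}^n$, put $\mathsf{T}_r(\widetilde M^\Omega) := \frac1p \sum_{i=1}^r \tilde\sigma_i \tilde u_i \tilde v_i^\top$. Then, with probability at least $1 - c_1 n^{-c_2}$, $$\left\| M - \mathsf{T}_r(\widetilde M^\Omega) \right\|_F \le c'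 \left( \frac{\sqrt r \log n}{p} \|M\|_\infty + \sqrt{\frac{r \log n}{p}}\, \|M\|_{\infty,2} \right)$$ for every choice of the singular value decomposition of $\widetilde M^\Omega$. Here $\|\cdot\|_F$ is the Frobenius norm, $\|M\|_\infty := \max_{i,j} |M_{ij}|$, and $\|M\|_{\infty,2} := \max\bigl\{ \max_i (\sum_b M_{ib}^2)^{1/2},\ \max_j (\sum_a M_{aj}^2)^{1/2} \bigr\}$ is the largest Euclidean norm of a row or column of $M$. -/

import Mathlib

open MeasureTheory ProbabilityTheory

noncomputable section

namespace SVDProjection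

variable {n : ℕ}

/-- `Om` is a random set of index pairs in which every pair `(i, j)` is present with probability
`p`, independently of all the others. -/
structure IsBernoulliSample {S : Type*} [MeasurableSpace S] (P : Measure S) (p : ℝ)
    (Om : S → Set (Fin n × Fin n)) : Prop where
  measurableSet_mem : ∀ e, MeasurableSet {ω | e ∈ Om ω}
  indep : iIndepSet (fun e ↦ {ω | e ∈ Om ω}) P
  prob : ∀ e, P.real {ω | e ∈ Om ω} = p

open Classical in
/-- `𝒫_Ω M`: all the unobserved entries are set to zero. -/
def observe (Om : Set (Fin n × Fin n)) (M : Matrix (Fin n) (Fin n) ℝ) :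
    Matrix (Fin n) (Fin n) ℝ :=
  Matrix.of fun i j ↦ if (i, j) ∈ Om then M i j else 0

open Classical in
/-- The number of non-zero entries of row `i`. -/
def rowDegree (A : Matrix (Fin n) (Fin n) ℝ) (i : Fin n) : ℕ :=
  (Finset.univ.filter fun j ↦ A i j ≠ 0).card

open Classical in
/-- The number of non-zero entries of column `j`. -/
def colDegree (A : Matrix (Fin n) (Fin n) ℝ) (j : Fin n) : ℕ :=
  (Finset.univ.filter fun i ↦ A i j ≠ 0).card

open Classical in
/-- All rows and all columns of `A` whose degree in `A` is larger than `2pn` are set to zero. -/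
def trim (p : ℝ) (A : Matrix (Fin n) (Fin n) ℝ) : Matrix (Fin n) (Fin n) ℝ :=
  Matrix.of fun i j ↦
    if 2 * p * n < rowDegree A i ∨ 2 * p * n < colDegree A j then 0 else A i j

/-- A singular value decomposition `A = ∑ i, σ i • u i (v i)ᵀ` with the singular values in
decreasing order. -/
structure SVD (A : Matrix (Fin n) (Fin n) ℝ) where
  u : OrthonormalBasis (Fin n) ℝ (EuclideanSpace ℝ (Fin n))
  v : OrthonormalBasis (Fin n) ℝ (EuclideanSpace ℝ (Fin n))
  σ : Fin n → ℝ
  σ_nonneg : ∀ i, 0 ≤ σ i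
  σ_antitone : Antitone σ
  eq_sum : A = ∑ i, σ i • Matrix.vecMulVec (u i).ofLp (v i).ofLp

/-- The rescaled rank-`r` projection `(1/p) ∑_{i ≤ r} σ i • u i (v i)ᵀ`
(indices start at `0` here). -/
def SVD.proj {A : Matrix (Fin n) (Fin n) ℝ} (D : SVD A) (p : ℝ) (r : ℕ) :
    Matrix (Fin n) (Fin n) ℝ :=
  (1 / p) • ∑ i : Fin n with i.val < r, D.σ i • Matrix.vecMulVec (D.u i).ofLp (D.v i).ofLp

/-- Every square real matrix has a singular value decomposition. -/
theorem nonempty_svd (A : Matrix (Fin n) (Fin n) ℝ) : Nonempty (SVD A) := by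
  let T := Matrix.toEuclideanLin A
  have hn : Module.finrank ℝ (EuclideanSpace ℝ (Fin n)) = n := by simp
  have hS := T.isSymmetric_adjoint_comp_self
  set v := hS.eigenvectorBasis hn with hv
  set l := hS.eigenvalues hn with hl
  have hl0 : ∀ i, 0 ≤ l i := T.isPositive_adjoint_comp_self.nonneg_eigenvalues hn
  have hin : ∀ i j, inner ℝ (T (v i)) (T (v j)) = if i = j then l j else 0 := by
    intro i j
    have h1 : (LinearMap.adjoint T) (T (v j)) = l j • v j := by
      exact hS.apply_eigenvectorBasis hn j
    rw [← LinearMap.adjoint_inner_right, h1, inner_smul_right,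
      orthonormal_iff_ite.1 v.orthonormal]
    split_ifs <;> simp
  let w : Fin n → EuclideanSpace ℝ (Fin n) := fun i ↦ (√(l i))⁻¹ • T (v i)
  have hw : Orthonormal ℝ (({i | l i ≠ 0} : Set (Fin n)).domRestrict w) := by
    rw [orthonormal_iff_ite]
    rintro ⟨i, hi⟩ ⟨j, hj⟩
    have hj' : 0 < l j := lt_of_le_of_ne (hl0 j) (Ne.symm hj)
    simp only [Set.domRestrict_apply, w, inner_smul_left, inner_smul_right, hin, Subtype.mk.injEq]
    split_ifs with h
    · subst h
      have := Real.mul_self_sqrt hj'.le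
      have h2 : √(l i) ≠ 0 := (Real.sqrt_pos.2 hj').ne'
      simp only [conj_trivial]
      field_simp
      nlinarith
    · simp
  obtain ⟨u, hu⟩ := hw.exists_orthonormalBasis_extension_of_card_eq (by simp)
  have hTv : ∀ i, T (v i) = √(l i) • u i := by
    intro i
    by_cases h : l i = 0
    · have : inner ℝ (T (v i)) (T (v i)) = 0 := by rw [hin, if_pos rfl, h]
      rw [inner_self_eq_zero.1 this, h]
      simp
    · have h2 : √(l i) ≠ 0 := (Real.sqrt_pos.2 (lt_of_le_of_ne (hl0 i) (Ne.symm h))).ne'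
      rw [hu i h]
      simp [w, smul_smul, h2]
  refine ⟨⟨u, v, fun i ↦ √(l i), fun i ↦ Real.sqrt_nonneg _,
    fun i j hij ↦ Real.sqrt_le_sqrt (hS.eigenvalues_antitone hn hij), ?_⟩⟩
  apply Matrix.toEuclideanLin.injective
  refine v.toBasis.ext fun k ↦ ?_
  change T _ = _
  rw [OrthonormalBasis.coe_toBasis, hTv]
  have hdot : ∀ i, (v i).ofLp ⬝ᵥ (v k).ofLp = if i = k then 1 else 0 := by
    intro i
    rw [← orthonormal_iff_ite.1 v.orthonormal i k]
    simp [PiLp.inner_apply, dotProduct, mul_comm]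
  ext a
  simp [Matrix.toLpLin_apply, Matrix.vecMulVec_mulVec, hdot, Finset.sum_apply, ite_apply]

/-- `‖Z‖_∞ = max_{i,j} |Z i j|`. -/
def maxNorm (Z : Matrix (Fin n) (Fin n) ℝ) : ℝ := ⨆ i, ⨆ j, |Z i j|

/-- `‖Z‖_{∞,2}`: the largest Euclidean norm of a row or a column. -/
def maxRowColNorm (Z : Matrix (Fin n) (Fin n) ℝ) : ℝ :=
  max (⨆ i, √(∑ b, Z i b ^ 2)) (⨆ j, √(∑ a, Z a j ^ 2))

/-- The Frobenius norm. -/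
def frobNorm (Z : Matrix (Fin n) (Fin n) ℝ) : ℝ := √(∑ i, ∑ j, Z i j ^ 2)

end SVDProjection

end

/-! Trimming plays no role with high probability. A Chernoff bound and a union over the `2n` rows
and columns show that no line has more than `2pn` observed positions, so the trimmed matrix is the
observed matrix itself. It remains to bound the operator norm of the centered matrix with entries
`(x e - p) * M e`. If this norm divided by `p` is at most `t`, Weyl's inequality bounds the
discarded singular values of the rescaled matrix by `t`, so the error has operator norm at most
`2t`. Since it has rank at most `2r`, its Frobenius norm is at most `√(8r) t`
(`SVD.frobNorm_sub_proj_le`).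

The operator norm is controlled by the trace of an even power `2k` of the symmetric dilation `X`,
with `k` about `log n`, so that the dimension factor costs only a constant. Discrete integration by
parts in each coordinate, together with a mean value trace inequality, gives `cubeExp_trace_pow_le`:
a moment of `X` is bounded by a lower moment weighted by `∑ e, (x e + p) • H e ^ 2`. For the
dilation this matrix is diagonal and holds random row and column sums of `M e ^ 2`. Young's
inequality absorbs the lower moment (`cubeExp_trace_dilation_le`), leaving moments of scalar sums,
which `cubeExp_sum_pow_le` bounds through the exponential moment. Markov's inequality concludes.

All probability is carried out as finite sums over the cube of Boolean outcomes;
`IsBernoulliSample.prob_ge` transfers the result to the given sample. -/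

noncomputable section

namespace SVDProjection

/-! ### Expectations on the Bernoulli cube. -/

section BernoulliCube

variable {ι : Type*} [Fintype ι]

/-- The probability of `x` under the product of Bernoulli(`p`) distributions. -/
def cubeWeight (p : ℝ) (x : ι → Bool) : ℝ := ∏ e, if x e then p else 1 - p

/-- The expectation of `F` under the product of Bernoulli(`p`) distributions. -/
def cubeExp [DecidableEq ι] (p : ℝ) (F : (ι → Bool) → ℝ) : ℝ := ∑ x, cubeWeight p x * F x

/-- The `e`-th coordinate as a real number. -/
def coord (x : ι → Bool) (e : ι) : ℝ := if x e then 1 else 0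

theorem cubeWeight_nonneg {p : ℝ} (h0 : 0 ≤ p) (h1 : p ≤ 1) (x : ι → Bool) :
    0 ≤ cubeWeight p x :=
  Finset.prod_nonneg fun e _ ↦ by split_ifs <;> linarith

variable [DecidableEq ι]

theorem cubeExp_mono {p : ℝ} (h0 : 0 ≤ p) (h1 : p ≤ 1) {F G : (ι → Bool) → ℝ}
    (h : ∀ x, F x ≤ G x) : cubeExp p F ≤ cubeExp p G :=
  Finset.sum_le_sum fun x _ ↦ mul_le_mul_of_nonneg_left (h x) (cubeWeight_nonneg h0 h1 x)

theorem cubeExp_add (p : ℝ) (F G : (ι → Bool) → ℝ) :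
    cubeExp p (fun x ↦ F x + G x) = cubeExp p F + cubeExp p G := by
  simp [cubeExp, mul_add, Finset.sum_add_distrib]

theorem cubeExp_sub (p : ℝ) (F G : (ι → Bool) → ℝ) :
    cubeExp p (fun x ↦ F x - G x) = cubeExp p F - cubeExp p G := by
  simp [cubeExp, mul_sub, Finset.sum_sub_distrib]

theorem cubeExp_const_mul (p c : ℝ) (F : (ι → Bool) → ℝ) :
    cubeExp p (fun x ↦ c * F x) = c * cubeExp p F := by
  simp only [cubeExp, Finset.mul_sum]
  exact Finset.sum_congr rfl fun x _ ↦ by ring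

theorem cubeExp_sum {κ : Type*} (s : Finset κ) (p : ℝ) (F : κ → (ι → Bool) → ℝ) :
    cubeExp p (fun x ↦ ∑ a ∈ s, F a x) = ∑ a ∈ s, cubeExp p (F a) := by
  simp only [cubeExp, Finset.mul_sum]
  exact Finset.sum_comm

/-- Independence of the coordinates. -/
theorem cubeExp_prod (p : ℝ) (f : ι → Bool → ℝ) :
    cubeExp p (fun x ↦ ∏ e, f e (x e)) = ∏ e, (p * f e true + (1 - p) * f e false) := by
  have := Finset.prod_univ_sum (fun _ : ι ↦ (Finset.univ : Finset Bool))
    (fun e b ↦ (if b then p else 1 - p) * f e b)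
  simp only [Fintype.sum_bool, Fintype.piFinset_univ] at this
  simp only [cubeExp, cubeWeight, ← Finset.prod_mul_distrib]
  rw [← this]
  simp

theorem cubeExp_one (p : ℝ) : cubeExp p (fun _ : ι → Bool ↦ 1) = 1 := by
  simpa using cubeExp_prod p (fun (_ : ι) _ ↦ 1)

/-- Averaging over one coordinate first. -/
theorem cubeExp_eq_update (p : ℝ) (e : ι) (F : (ι → Bool) → ℝ) :
    cubeExp p F = p * cubeExp p (fun x ↦ F (Function.update x e true)) +
      (1 - p) * cubeExp p (fun x ↦ F (Function.update x e false)) := by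
  -- `R` is the weight of the coordinates other than `e`; once the cube is split as `Bool` times the
  -- rest, an update at `e` only overwrites the first factor.
  let R : ({j // j ≠ e} → Bool) → ℝ := fun y ↦ ∏ j, if y j then p else 1 - p
  have key : ∀ G : (ι → Bool) → ℝ, cubeExp p G =
      ∑ y : {j // j ≠ e} → Bool, R y * (p * G ((Equiv.funSplitAt e Bool).symm (true, y)) +
        (1 - p) * G ((Equiv.funSplitAt e Bool).symm (false, y))) := by
    intro G
    have hw : ∀ b y, cubeWeight p ((Equiv.funSplitAt e Bool).symm (b, y)) =
        (if b then p else 1 - p) * R y := by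
      intro b y
      rw [cubeWeight, Fintype.prod_eq_mul_prod_subtype_ne _ e]
      congr 1
      · simp [Equiv.funSplitAt, Equiv.piSplitAt]
      · exact Finset.prod_congr rfl fun j _ ↦ by
          simp [Equiv.funSplitAt, Equiv.piSplitAt, j.2]
    rw [cubeExp, ← (Equiv.funSplitAt e Bool).symm.sum_comp, Fintype.sum_prod_type,
      Fintype.sum_bool, ← Finset.sum_add_distrib]
    refine Finset.sum_congr rfl fun y _ ↦ ?_
    rw [hw, hw]
    simp only [if_true, Bool.false_eq_true, if_false]
    ring
  have hu : ∀ b c y, Function.update ((Equiv.funSplitAt e Bool).symm (b, y)) e c =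
      (Equiv.funSplitAt e Bool).symm (c, y) := by
    intro b c y
    ext j
    by_cases h : j = e
    · subst h; simp [Equiv.funSplitAt, Equiv.piSplitAt]
    · simp [Equiv.funSplitAt, Equiv.piSplitAt, h]
  rw [key F, key, key, Finset.mul_sum, Finset.mul_sum, ← Finset.sum_add_distrib]
  refine Finset.sum_congr rfl fun y _ ↦ ?_
  simp only [hu]
  ring

/-- Discrete integration by parts. -/
theorem cubeExp_coord_sub_mul (p : ℝ) (e : ι) (F : (ι → Bool) → ℝ) :
    cubeExp p (fun x ↦ (coord x e - p) * F x) = p * (1 - p) *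
      cubeExp p (fun x ↦ F (Function.update x e true) - F (Function.update x e false)) := by
  rw [cubeExp_eq_update p e, cubeExp_sub]
  simp only [coord, Function.update_self, if_true, Bool.false_eq_true, if_false,
    cubeExp_const_mul]
  ring

/-- Undoes the resampling left by integration by parts: the value `true` has probability `p` and
receives weight `1 - p`, and conversely for `false`. -/
theorem cubeExp_update_add (p : ℝ) (e : ι) (F : (ι → Bool) → ℝ) :
    p * (1 - p) *
      cubeExp p (fun x ↦ F (Function.update x e true) + F (Function.update x e false)) =
    cubeExp p (fun x ↦ ((1 - p) * coord x e + p * (1 - coord x e)) * F x) := by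
  rw [cubeExp_eq_update p e (fun x ↦ (_ + _) * F x), cubeExp_add]
  simp only [coord, Function.update_self, if_true, Bool.false_eq_true, if_false,
    cubeExp_const_mul]
  ring

theorem cubeExp_exp_sum (p : ℝ) (a : ι → ℝ) :
    cubeExp p (fun x ↦ Real.exp (∑ e, coord x e * a e)) =
      ∏ e, (p * Real.exp (a e) + (1 - p)) := by
  have := cubeExp_prod p (fun e b ↦ Real.exp ((if b then 1 else 0) * a e))
  simp only [if_true, Bool.false_eq_true, if_false, one_mul, zero_mul, Real.exp_zero,
    mul_one] at this
  rw [← this]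
  congr 1
  ext x
  rw [Real.exp_sum]
  rfl

/-- A Bernstein type bound for the moment generating function. -/
theorem cubeExp_exp_sum_le {p : ℝ} (h0 : 0 ≤ p) (h1 : p ≤ 1) (a : ι → ℝ)
    (ha0 : ∀ e, 0 ≤ a e) (ha1 : ∀ e, a e ≤ 1) :
    cubeExp p (fun x ↦ Real.exp (∑ e, coord x e * a e)) ≤
      Real.exp (p * ∑ e, (a e + a e ^ 2)) := by
  rw [cubeExp_exp_sum, Finset.mul_sum, Real.exp_sum]
  refine Finset.prod_le_prod (fun e _ ↦ ?_) fun e _ ↦ ?_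
  · have := Real.exp_pos (a e)
    have : 0 ≤ p * Real.exp (a e) := by positivity
    linarith
  · have h : Real.exp (a e) ≤ 1 + a e + a e ^ 2 := by
      have := Real.abs_exp_sub_one_sub_id_le (x := a e) (by
        rw [abs_of_nonneg (ha0 e)]; exact ha1 e)
      have := (abs_le.1 this).2
      linarith
    have h2 := Real.add_one_le_exp (p * (a e + a e ^ 2))
    nlinarith

theorem cubeExp_markov {p : ℝ} (h0 : 0 ≤ p) (h1 : p ≤ 1) {F : (ι → Bool) → ℝ}
    (hF : ∀ x, 0 ≤ F x) {t : ℝ} (s : Set (ι → Bool)) [DecidablePred (· ∈ s)]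
    (hs : ∀ x ∈ s, t ≤ F x) :
    t * cubeExp p (fun x ↦ if x ∈ s then 1 else 0) ≤ cubeExp p F := by
  rw [← cubeExp_const_mul]
  refine cubeExp_mono h0 h1 fun x ↦ ?_
  split_ifs with h
  · simpa using hs x h
  · simpa using hF x

end BernoulliCube

/-! ### From the sample to the cube. -/

variable {n : ℕ}

/-- The law of a Bernoulli sample is the product of Bernoulli distributions. -/
theorem IsBernoulliSample.prob_cylinder {S : Type*} [MeasurableSpace S] {P : Measure S}
    [IsProbabilityMeasure P] {p : ℝ} {Om : S → Set (Fin n × Fin n)}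
    (h : IsBernoulliSample P p Om) (x : Fin n × Fin n → Bool) :
    P.real {ω | ∀ e, e ∈ Om ω ↔ x e = true} = cubeWeight p x := by
  let s : Fin n × Fin n → Set S := fun e ↦
    if x e then {ω | e ∈ Om ω} else {ω | e ∈ Om ω}ᶜ
  have hset : {ω | ∀ e, e ∈ Om ω ↔ x e = true} = ⋂ e, s e := by
    ext ω
    simp only [Set.mem_ofPred_eq, Set.mem_iInter, s]
    refine forall_congr' fun e ↦ ?_
    cases hx : x e <;> simp
  -- Each factor may be an event or its complement, so independence is used for the generated
  -- σ-algebras.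
  have hm : ∀ e, MeasurableSet[MeasurableSpace.generateFrom {{ω | e ∈ Om ω}}] (s e) := by
    intro e
    have := MeasurableSpace.measurableSet_generateFrom (s := {{ω | e ∈ Om ω}})
      (Set.mem_singleton _)
    simp only [s]
    split_ifs
    · exact this
    · exact this.compl
  have hi := iIndep.meas_iInter h.indep hm
  rw [hset, Measure.real, hi, ENNReal.toReal_prod, cubeWeight]
  refine Finset.prod_congr rfl fun e _ ↦ ?_
  change P.real (s e) = _
  simp only [s]
  split_ifs
  · exact h.prob e
  · rw [probReal_compl_eq_one_sub (h.measurableSet_mem e), h.prob e]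

-- The cylinders of the outcomes satisfying `Q` are disjoint and lie inside the event. Only this
-- inclusion is needed, so measurability of the event itself never enters.
open Classical in
theorem IsBernoulliSample.prob_ge {S : Type*} [MeasurableSpace S] {P : Measure S}
    [IsProbabilityMeasure P] {p : ℝ} {Om : S → Set (Fin n × Fin n)}
    (h : IsBernoulliSample P p Om) (Q : Set (Fin n × Fin n) → Prop) :
    cubeExp p (fun x : Fin n × Fin n → Bool ↦ if Q {e | x e = true} then 1 else 0) ≤
      P.real {ω | Q (Om ω)} := by
  let C : (Fin n × Fin n → Bool) → Set S := fun x ↦ {ω | ∀ e, e ∈ Om ω ↔ x e = true}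
  have hC : ∀ x, MeasurableSet (C x) := by
    intro x
    have : C x = ⋂ e, {ω | e ∈ Om ω ↔ x e = true} := by ext; simp [C]
    rw [this]
    refine MeasurableSet.iInter fun e ↦ ?_
    cases hx : x e
    · have : {ω | e ∈ Om ω ↔ false = true} = {ω | e ∈ Om ω}ᶜ := by ext; simp
      rw [this]
      exact (h.measurableSet_mem e).compl
    · simpa [hx] using h.measurableSet_mem e
  have hd : ∀ x y, x ≠ y → Disjoint (C x) (C y) := by
    intro x y hxy
    rw [Set.disjoint_left]
    intro ω hx hy
    refine hxy (funext fun e ↦ ?_)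
    have := (hx e).symm.trans (hy e)
    cases hx : x e <;> cases hy : y e <;> simp_all
  let G := Finset.univ.filter fun x : Fin n × Fin n → Bool ↦ Q {e | x e = true}
  have hU : P.real (⋃ x ∈ G, C x) = ∑ x ∈ G, P.real (C x) :=
    measureReal_biUnion_finset (fun x _ y _ hxy ↦ hd x y hxy) (fun x _ ↦ hC x)
  have hE : cubeExp p (fun x : Fin n × Fin n → Bool ↦ if Q {e | x e = true} then 1 else 0) =
      ∑ x ∈ G, P.real (C x) := by
    simp only [cubeExp, mul_ite, mul_one, mul_zero, G, Finset.sum_filter]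
    exact Finset.sum_congr rfl fun x _ ↦ by rw [h.prob_cylinder x]
  rw [hE, ← hU]
  refine measureReal_mono ?_
  intro ω hω
  simp only [Set.mem_iUnion] at hω
  obtain ⟨x, hx, hω⟩ := hω
  have : Om ω = {e | x e = true} := Set.ext hω
  simp only [Set.mem_ofPred_eq, this]
  exact (Finset.mem_filter.1 hx).2

/-! ### Trace inequalities for symmetric matrices. -/

section TraceInequalities

variable {m : Type*} [Fintype m] [DecidableEq m]

open Matrix

/-- A real symmetric matrix is orthogonally diagonalizable. -/
theorem exists_diagonalization {A : Matrix m m ℝ} (hA : A.IsSymm) :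
    ∃ (U : Matrix m m ℝ) (l : m → ℝ), Uᵀ * U = 1 ∧ U * Uᵀ = 1 ∧
      ∀ k, A ^ k = U * diagonal (fun i ↦ l i ^ k) * Uᵀ := by
  have hH : A.IsHermitian := by
    rw [Matrix.IsHermitian, conjTranspose_eq_transpose_of_trivial]; exact hA
  let U : Matrix m m ℝ := hH.eigenvectorUnitary
  have h1 : Uᵀ * U = 1 := by
    have := Unitary.coe_star_mul_self hH.eigenvectorUnitary
    rwa [star_eq_conjTranspose, conjTranspose_eq_transpose_of_trivial] at this
  have h2 : U * Uᵀ = 1 := by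
    have := Unitary.coe_mul_star_self hH.eigenvectorUnitary
    rwa [Unitary.coe_star, star_eq_conjTranspose, conjTranspose_eq_transpose_of_trivial] at this
  have h3 : A = U * diagonal hH.eigenvalues * Uᵀ := by
    have := hH.spectral_theorem
    rw [Unitary.conjStarAlgAut_apply, star_eq_conjTranspose,
      conjTranspose_eq_transpose_of_trivial] at this
    exact this
  refine ⟨U, hH.eigenvalues, h1, h2, fun k ↦ ?_⟩
  induction k with
  | zero => simp [h2]
  | succ k ih =>
    rw [pow_succ, ih]
    nth_rewrite 2 [h3]
    calc U * diagonal (fun i ↦ hH.eigenvalues i ^ k) * Uᵀ *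
          (U * diagonal hH.eigenvalues * Uᵀ)
        = U * diagonal (fun i ↦ hH.eigenvalues i ^ k) * (Uᵀ * U) *
          diagonal hH.eigenvalues * Uᵀ := by simp only [Matrix.mul_assoc]
      _ = _ := by
        rw [h1, Matrix.mul_one, Matrix.mul_assoc U, diagonal_mul_diagonal]
        simp only [pow_succ]

/-- Pair the exponents `q` and `2N - q`: the differences `|a|^q - |b|^q` and `|a|^(2N-q) -
|b|^(2N-q)` have the same sign, so their product is nonnegative. Evenness of `2N` removes the
absolute values. -/
theorem sum_pow_mul_pow_le (a b : ℝ) (N : ℕ) :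
    ∑ q ∈ Finset.range (2 * N + 1), a ^ q * b ^ (2 * N - q) ≤
      (2 * N + 1) / 2 * (a ^ (2 * N) + b ^ (2 * N)) := by
  have habs : ∑ q ∈ Finset.range (2 * N + 1), a ^ q * b ^ (2 * N - q) ≤
      ∑ q ∈ Finset.range (2 * N + 1), |a| ^ q * |b| ^ (2 * N - q) :=
    Finset.sum_le_sum fun q _ ↦ (le_abs_self _).trans (by rw [abs_mul, abs_pow, abs_pow])
  have hrefl : ∑ q ∈ Finset.range (2 * N + 1), |a| ^ q * |b| ^ (2 * N - q) =
      ∑ q ∈ Finset.range (2 * N + 1), |a| ^ (2 * N - q) * |b| ^ q := by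
    rw [← Finset.sum_range_reflect]
    refine Finset.sum_congr rfl fun q hq ↦ ?_
    have hq := Finset.mem_range.1 hq
    rw [show 2 * N + 1 - 1 - q = 2 * N - q by omega, show 2 * N - (2 * N - q) = q by omega]
  have hpair : ∑ q ∈ Finset.range (2 * N + 1),
      (|a| ^ q * |b| ^ (2 * N - q) + |a| ^ (2 * N - q) * |b| ^ q) ≤
      ∑ q ∈ Finset.range (2 * N + 1), (a ^ (2 * N) + b ^ (2 * N)) := by
    refine Finset.sum_le_sum fun q hq ↦ ?_
    have hq := Finset.mem_range.1 hq
    have ha : a ^ (2 * N) = |a| ^ q * |a| ^ (2 * N - q) := by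
      rw [← pow_add, show q + (2 * N - q) = 2 * N by omega, Even.pow_abs ⟨N, by omega⟩]
    have hb : b ^ (2 * N) = |b| ^ q * |b| ^ (2 * N - q) := by
      rw [← pow_add, show q + (2 * N - q) = 2 * N by omega, Even.pow_abs ⟨N, by omega⟩]
    rw [ha, hb]
    rcases le_total |a| |b| with h | h
    · have h1 := pow_le_pow_left₀ (abs_nonneg a) h q
      have h2 := pow_le_pow_left₀ (abs_nonneg a) h (2 * N - q)
      nlinarith [mul_nonneg (sub_nonneg.2 h1) (sub_nonneg.2 h2)]
    · have h1 := pow_le_pow_left₀ (abs_nonneg b) h q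
      have h2 := pow_le_pow_left₀ (abs_nonneg b) h (2 * N - q)
      nlinarith [mul_nonneg (sub_nonneg.2 h1) (sub_nonneg.2 h2)]
  rw [Finset.sum_add_distrib, ← hrefl, Finset.sum_const, Finset.card_range, nsmul_eq_mul]
    at hpair
  push_cast at hpair
  linarith

theorem trace_mul_diagonal_mul_transpose_mul_diagonal (K : Matrix m m ℝ) (a b : m → ℝ) :
    (K * diagonal a * Kᵀ * diagonal b).trace = ∑ i, ∑ j, K i j ^ 2 * a j * b i := by
  simp only [trace, diag_apply, mul_diagonal]
  simp only [Matrix.mul_apply (M := K * diagonal a), mul_diagonal, transpose_apply,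
    Finset.sum_mul]
  exact Finset.sum_congr rfl fun i _ ↦ Finset.sum_congr rfl fun j _ ↦ by ring

/-- The mean value trace inequality for even powers. -/
theorem sum_trace_mul_pow_mul_pow_le {A B H : Matrix m m ℝ} (hA : A.IsSymm) (hB : B.IsSymm)
    (hH : H.IsSymm) (N : ℕ) :
    ∑ q ∈ Finset.range (2 * N + 1), (H * A ^ q * H * B ^ (2 * N - q)).trace ≤
      (2 * N + 1) / 2 * ((H ^ 2 * A ^ (2 * N)).trace + (H ^ 2 * B ^ (2 * N)).trace) := by
  obtain ⟨U, a, hU1, hU2, hUa⟩ := exists_diagonalization hA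
  obtain ⟨V, b, hV1, hV2, hVb⟩ := exists_diagonalization hB
  -- Diagonalizing `A` and `B` separately turns the traces into sums with common nonnegative weights
  -- `(Vᵀ H U) i j ^ 2`, so the scalar inequality applies to each pair of eigenvalues.
  have key : ∀ s t, (H * A ^ s * H * B ^ t).trace =
      ∑ i, ∑ j, (Vᵀ * H * U) i j ^ 2 * a j ^ s * b i ^ t := by
    intro s t
    rw [← trace_mul_diagonal_mul_transpose_mul_diagonal, hUa, hVb]
    simp only [transpose_mul, transpose_transpose, hH.eq]
    calc (H * (U * diagonal (fun i ↦ a i ^ s) * Uᵀ) * H *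
          (V * diagonal (fun i ↦ b i ^ t) * Vᵀ)).trace
        = (H * U * diagonal (fun i ↦ a i ^ s) * Uᵀ * H *
          V * diagonal (fun i ↦ b i ^ t) * Vᵀ).trace := by simp only [Matrix.mul_assoc]
      _ = _ := by rw [trace_mul_comm]; simp only [Matrix.mul_assoc]
  have hA' : (H ^ 2 * A ^ (2 * N)).trace = (H * A ^ (2 * N) * H * B ^ 0).trace := by
    rw [pow_zero, Matrix.mul_one, trace_mul_comm (H * A ^ (2 * N)) H, ← Matrix.mul_assoc, sq]
  have hB' : (H ^ 2 * B ^ (2 * N)).trace = (H * A ^ 0 * H * B ^ (2 * N)).trace := by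
    rw [pow_zero, Matrix.mul_one, sq]
  rw [hA', hB', key, key, Finset.sum_congr rfl fun q _ ↦ key q (2 * N - q), Finset.sum_comm,
    ← Finset.sum_add_distrib, Finset.mul_sum]
  refine Finset.sum_le_sum fun i _ ↦ ?_
  rw [Finset.sum_comm, ← Finset.sum_add_distrib, Finset.mul_sum]
  refine Finset.sum_le_sum fun j _ ↦ ?_
  simp only [mul_assoc, ← Finset.mul_sum]
  have := mul_le_mul_of_nonneg_left (sum_pow_mul_pow_le (a j) (b i) N)
    (sq_nonneg ((Vᵀ * H * U) i j))
  simp only [Matrix.mul_assoc] at this ⊢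
  linarith

theorem pow_succ_sub_pow_succ (A B : Matrix m m ℝ) (N : ℕ) :
    A ^ (N + 1) - B ^ (N + 1) =
      ∑ q ∈ Finset.range (N + 1), A ^ q * (A - B) * B ^ (N - q) := by
  induction N with
  | zero => simp
  | succ N ih =>
    have h : A ^ (N + 2) - B ^ (N + 2) =
        A ^ (N + 1) * (A - B) + (A ^ (N + 1) - B ^ (N + 1)) * B := by
      rw [Matrix.mul_sub, Matrix.sub_mul, ← pow_succ, ← pow_succ]; abel
    rw [h, ih, Finset.sum_range_succ _ (N + 1), Finset.sum_mul, add_comm]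
    congr 1
    · refine Finset.sum_congr rfl fun q hq ↦ ?_
      have hq := Finset.mem_range.1 hq
      rw [Matrix.mul_assoc, ← pow_succ, show N - q + 1 = N + 1 - q by omega]
    · simp

/-- Weighted AM–GM, kept to natural exponents; the induction step adds `(a - b) * (a^(N+1) -
b^(N+1)) ≥ 0`. -/
theorem young_pow {a b : ℝ} (ha : 0 ≤ a) (hb : 0 ≤ b) (N : ℕ) :
    (N + 1) * (a * b ^ N) ≤ a ^ (N + 1) + N * b ^ (N + 1) := by
  induction N with
  | zero => simp
  | succ N ih =>
    have h1 := mul_le_mul_of_nonneg_right ih hb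
    have h2 : 0 ≤ (a - b) * (a ^ (N + 1) - b ^ (N + 1)) := by
      rcases le_total a b with h | h
      · have := pow_le_pow_left₀ ha h (N + 1)
        nlinarith
      · have := pow_le_pow_left₀ hb h (N + 1)
        nlinarith
    push_cast
    have e1 : a ^ (N + 1 + 1) = a * a ^ (N + 1) := pow_succ' ..
    have e2 : b ^ (N + 1 + 1) = b * b ^ (N + 1) := pow_succ' ..
    have e3 : b ^ (N + 1) = b * b ^ N := pow_succ' ..
    rw [e1, e2]
    rw [e3] at h1 h2 ⊢
    nlinarith

/-- A diagonal entry of `A ^ (2 * N)` is an average of the `2N`-th powers of the eigenvalues `l j`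
with weights `U i j ^ 2`. Young's inequality for `z i` and `l j ^ 2` is averaged with these weights.
-/
theorem sum_diag_pow_le {A : Matrix m m ℝ} (hA : A.IsSymm) (N : ℕ) {z : m → ℝ}
    (hz : ∀ i, 0 ≤ z i) :
    (N + 1) * ∑ i, z i * (A ^ (2 * N)) i i ≤
      ∑ i, z i ^ (N + 1) + N * (A ^ (2 * (N + 1))).trace := by
  obtain ⟨U, l, hU1, hU2, hU⟩ := exists_diagonalization hA
  have hd : ∀ k i, (A ^ k) i i = ∑ j, U i j ^ 2 * l j ^ k := by
    intro k i
    rw [hU, Matrix.mul_apply]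
    simp only [mul_diagonal, transpose_apply]
    exact Finset.sum_congr rfl fun j _ ↦ by ring
  have h1 : ∀ i, ∑ j, U i j ^ 2 = 1 := fun i ↦ by simpa using (hd 0 i).symm
  simp only [trace, diag_apply, hd, Finset.mul_sum]
  rw [← Finset.sum_add_distrib]
  refine Finset.sum_le_sum fun i _ ↦ ?_
  calc ∑ j, (N + 1) * (z i * (U i j ^ 2 * l j ^ (2 * N)))
      ≤ ∑ j, U i j ^ 2 * (z i ^ (N + 1) + N * (l j ^ 2) ^ (N + 1)) := by
        refine Finset.sum_le_sum fun j _ ↦ ?_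
        have := mul_le_mul_of_nonneg_left (young_pow (hz i) (sq_nonneg (l j)) N)
          (sq_nonneg (U i j))
        rw [pow_mul]
        linarith
    _ = _ := by
        simp only [mul_add, Finset.sum_add_distrib, ← Finset.sum_mul, h1, one_mul]
        congr 1
        exact Finset.sum_congr rfl fun j _ ↦ by ring

theorem trace_pow_two_mul_nonneg {A : Matrix m m ℝ} (hA : A.IsSymm) (N : ℕ) :
    0 ≤ (A ^ (2 * N)).trace := by
  obtain ⟨U, l, hU1, hU2, hU⟩ := exists_diagonalization hA
  rw [hU, trace_mul_comm, ← Matrix.mul_assoc, hU1, Matrix.one_mul, trace_diagonal]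
  exact Finset.sum_nonneg fun i _ ↦ by rw [pow_mul]; positivity

theorem diag_pow_two_mul_nonneg {A : Matrix m m ℝ} (hA : A.IsSymm) (N : ℕ) (i : m) :
    0 ≤ (A ^ (2 * N)) i i := by
  obtain ⟨U, l, hU1, hU2, hU⟩ := exists_diagonalization hA
  rw [hU, Matrix.mul_apply]
  simp only [mul_diagonal, transpose_apply]
  exact Finset.sum_nonneg fun j _ ↦ by
    have : U i j * l j ^ (2 * N) * U i j = U i j ^ 2 * (l j ^ 2) ^ N := by rw [pow_mul]; ring
    rw [this]; positivity

/-- The operator norm is bounded by even Schatten norms. -/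
theorem mulVec_dotProduct_le_of_trace_pow_le {A : Matrix m m ℝ} (hA : A.IsSymm) {N : ℕ}
    (hN : N ≠ 0) {T : ℝ} (hT : 0 ≤ T) (h : (A ^ (2 * N)).trace ≤ T ^ N) (z : m → ℝ) :
    (A *ᵥ z) ⬝ᵥ (A *ᵥ z) ≤ T * (z ⬝ᵥ z) := by
  obtain ⟨U, l, hU1, hU2, hU⟩ := exists_diagonalization hA
  have htr : (A ^ (2 * N)).trace = ∑ i, (l i ^ 2) ^ N := by
    rw [hU, trace_mul_comm, ← Matrix.mul_assoc, hU1, Matrix.one_mul, trace_diagonal]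
    simp only [pow_mul]
  have hl : ∀ i, l i ^ 2 ≤ T := by
    intro i
    have := Finset.single_le_sum (f := fun i ↦ (l i ^ 2) ^ N) (fun j _ ↦ by positivity)
      (Finset.mem_univ i)
    exact le_of_pow_le_pow_left₀ hN hT (by linarith)
  have e1 : (A *ᵥ z) ⬝ᵥ (A *ᵥ z) = ∑ i, l i ^ 2 * (Uᵀ *ᵥ z) i ^ 2 := by
    have : (A *ᵥ z) ⬝ᵥ (A *ᵥ z) = z ⬝ᵥ ((A ^ 2) *ᵥ z) := by
      rw [sq, ← mulVec_mulVec, dotProduct_mulVec z A, ← mulVec_transpose, hA.eq]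
    rw [this, hU, ← mulVec_mulVec, ← mulVec_mulVec, dotProduct_mulVec, ← mulVec_transpose]
    simp only [dotProduct, mulVec_diagonal]
    exact Finset.sum_congr rfl fun i _ ↦ by ring
  have e2 : z ⬝ᵥ z = ∑ i, (Uᵀ *ᵥ z) i ^ 2 := by
    have : z ⬝ᵥ z = z ⬝ᵥ ((U * Uᵀ) *ᵥ z) := by rw [hU2, one_mulVec]
    rw [this, ← mulVec_mulVec, dotProduct_mulVec, ← mulVec_transpose]
    simp only [dotProduct]
    exact Finset.sum_congr rfl fun i _ ↦ by ring
  rw [e1, e2, Finset.mul_sum]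
  exact Finset.sum_le_sum fun i _ ↦ mul_le_mul_of_nonneg_right (hl i) (sq_nonneg _)

end TraceInequalities

/-! ### Moment bounds for Bernoulli series. -/

section MomentBound

open Matrix

variable {ι m : Type*} [Fintype ι]

/-- The centered Bernoulli series `∑ e, (x e - p) • H e`. -/
def bernoulliSeries (p : ℝ) (H : ι → Matrix m m ℝ) (x : ι → Bool) : Matrix m m ℝ :=
  ∑ e, (coord x e - p) • H e

theorem bernoulliSeries_isSymm (p : ℝ) {H : ι → Matrix m m ℝ} (hH : ∀ e, (H e).IsSymm)
    (x : ι → Bool) : (bernoulliSeries p H x).IsSymm := by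
  simp only [Matrix.IsSymm, bernoulliSeries, transpose_sum, transpose_smul, (hH _).eq]

variable [DecidableEq ι]

theorem bernoulliSeries_update_sub (p : ℝ) (H : ι → Matrix m m ℝ) (x : ι → Bool) (e : ι) :
    bernoulliSeries p H (Function.update x e true) -
      bernoulliSeries p H (Function.update x e false) = H e := by
  rw [bernoulliSeries, bernoulliSeries, ← Finset.sum_sub_distrib,
    Finset.sum_eq_single e]
  · rw [← sub_smul]
    simp [coord]
  · intro j _ hj
    simp [coord, hj]
  · simp

variable [Fintype m] [DecidableEq m]

theorem trace_sq_mul_pow_nonneg {A H : Matrix m m ℝ} (hA : A.IsSymm) (hH : H.IsSymm) (N : ℕ) :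
    0 ≤ (H ^ 2 * A ^ (2 * N)).trace := by
  have : (H ^ 2 * A ^ (2 * N)).trace = ((A ^ N * H)ᵀ * (A ^ N * H)).trace := by
    rw [transpose_mul, transpose_pow, hA.eq, hH.eq, two_mul, pow_add, sq, Matrix.mul_assoc,
      trace_mul_comm]
    simp only [Matrix.mul_assoc]
  rw [this]
  simp only [trace, diag_apply, Matrix.mul_apply, transpose_apply]
  exact Finset.sum_nonneg fun i _ ↦ Finset.sum_nonneg fun j _ ↦ mul_self_nonneg _

/-- A matrix Efron–Stein inequality for even trace moments. -/
theorem cubeExp_trace_pow_le {p : ℝ} (h0 : 0 ≤ p) (h1 : p ≤ 1) {H : ι → Matrix m m ℝ}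
    (hH : ∀ e, (H e).IsSymm) (N : ℕ) :
    cubeExp p (fun x ↦ ((bernoulliSeries p H x) ^ (2 * (N + 1))).trace) ≤
      (2 * N + 1) / 2 * cubeExp p (fun x ↦
        ∑ e, (coord x e + p) * (H e ^ 2 * (bernoulliSeries p H x) ^ (2 * N)).trace) := by
  have hexp : ∀ x, ((bernoulliSeries p H x) ^ (2 * (N + 1))).trace =
      ∑ e, (coord x e - p) * (H e * (bernoulliSeries p H x) ^ (2 * N + 1)).trace := by
    intro x
    rw [show 2 * (N + 1) = (2 * N + 1) + 1 by ring, pow_succ']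
    nth_rewrite 1 [bernoulliSeries]
    -- One factor of the power is expanded as the series, which exposes a factor `x e - p` for
    -- integration by parts.
    rw [Finset.sum_mul, trace_sum]
    exact Finset.sum_congr rfl fun e _ ↦ by rw [smul_mul, trace_smul, smul_eq_mul]
  simp only [hexp]
  rw [cubeExp_sum, cubeExp_sum, Finset.mul_sum]
  refine Finset.sum_le_sum fun e _ ↦ ?_
  have hp : 0 ≤ p * (1 - p) := mul_nonneg h0 (by linarith)
  let G : (ι → Bool) → ℝ := fun x ↦ (H e ^ 2 * (bernoulliSeries p H x) ^ (2 * N)).trace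
  calc cubeExp p (fun x ↦ (coord x e - p) * (H e * (bernoulliSeries p H x) ^ (2 * N + 1)).trace)
      = p * (1 - p) * cubeExp p (fun x ↦
          (H e * (bernoulliSeries p H (Function.update x e true)) ^ (2 * N + 1)).trace -
          (H e * (bernoulliSeries p H (Function.update x e false)) ^ (2 * N + 1)).trace) :=
        cubeExp_coord_sub_mul p e _
    _ ≤ p * (1 - p) * cubeExp p (fun x ↦ (2 * N + 1) / 2 *
          (G (Function.update x e true) + G (Function.update x e false))) := by
        -- Flipping coordinate `e` changes the series by exactly `H e`, so the difference of the
        -- `(2N+1)`-th powers telescopes into the sum of the mean value trace inequality.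
        refine mul_le_mul_of_nonneg_left (cubeExp_mono h0 h1 fun x ↦ ?_) hp
        rw [← trace_sub, ← Matrix.mul_sub, pow_succ_sub_pow_succ, bernoulliSeries_update_sub,
          Finset.mul_sum, trace_sum]
        refine le_trans (le_of_eq ?_) (sum_trace_mul_pow_mul_pow_le
          (bernoulliSeries_isSymm p hH _) (bernoulliSeries_isSymm p hH _) (hH e) N)
        exact Finset.sum_congr rfl fun q _ ↦ by simp only [Matrix.mul_assoc]
    _ = (2 * N + 1) / 2 * cubeExp p (fun x ↦
          ((1 - p) * coord x e + p * (1 - coord x e)) * G x) := by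
        rw [cubeExp_const_mul, ← cubeExp_update_add]
        ring
    _ ≤ (2 * N + 1) / 2 * cubeExp p (fun x ↦ (coord x e + p) * G x) := by
        refine mul_le_mul_of_nonneg_left (cubeExp_mono h0 h1 fun x ↦ ?_) (by positivity)
        refine mul_le_mul_of_nonneg_right ?_
          (trace_sq_mul_pow_nonneg (bernoulliSeries_isSymm p hH x) (hH e) N)
        unfold coord
        split_ifs <;> linarith

/-- For the sum `y`, `y ^ k ≤ k! τ ^ k exp (y / τ)` and `k! ≤ k ^ k`. In the exponent, the
deterministic part contributes at most `k` and the moment generating function at most `2k`, whence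
`exp 3`. -/
theorem cubeExp_sum_pow_le {p : ℝ} (h0 : 0 ≤ p) (h1 : p ≤ 1) {a : ι → ℝ} {τ : ℝ} (hτ : 0 < τ)
    (ha0 : ∀ e, 0 ≤ a e) (haτ : ∀ e, a e ≤ τ) {k : ℕ} (hv : p * ∑ e, a e ≤ k * τ) :
    cubeExp p (fun x ↦ (∑ e, (coord x e + p) * a e) ^ k) ≤
      (Real.exp 3 * (k * τ)) ^ k := by
  have hpt : ∀ x : ι → Bool, (∑ e, (coord x e + p) * a e) ^ k ≤
      (τ * k) ^ k * Real.exp k * Real.exp (∑ e, coord x e * (a e / τ)) := by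
    intro x
    set y := ∑ e, (coord x e + p) * a e with hy
    have hy0 : 0 ≤ y := Finset.sum_nonneg fun e _ ↦ by
      have := ha0 e
      unfold coord
      split_ifs <;> positivity
    have e1 : y / τ = ∑ e, coord x e * (a e / τ) + p * (∑ e, a e) / τ := by
      rw [hy, Finset.mul_sum, Finset.sum_div, Finset.sum_div, ← Finset.sum_add_distrib]
      exact Finset.sum_congr rfl fun e _ ↦ by ring
    have e2 : p * (∑ e, a e) / τ ≤ k := by rwa [div_le_iff₀ hτ]
    have h3 := Real.pow_div_factorial_le_exp (y / τ) (by positivity) k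
    have h4 : (k.factorial : ℝ) ≤ (k : ℝ) ^ k := by exact_mod_cast Nat.factorial_le_pow k
    have h5 : Real.exp (y / τ) ≤ Real.exp k * Real.exp (∑ e, coord x e * (a e / τ)) := by
      rw [← Real.exp_add, Real.exp_le_exp, e1]; linarith
    rw [div_le_iff₀ (by positivity)] at h3
    calc y ^ k = τ ^ k * (y / τ) ^ k := by rw [← mul_pow, mul_div_cancel₀ _ hτ.ne']
      _ ≤ τ ^ k * ((Real.exp k * Real.exp (∑ e, coord x e * (a e / τ))) * (k : ℝ) ^ k) := by
          refine mul_le_mul_of_nonneg_left (h3.trans ?_) (by positivity)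
          exact mul_le_mul h5 h4 (by positivity) (by positivity)
      _ = _ := by rw [mul_pow]; ring
  refine (cubeExp_mono h0 h1 hpt).trans ?_
  rw [cubeExp_const_mul]
  have hm := cubeExp_exp_sum_le h0 h1 (fun e ↦ a e / τ) (fun e ↦ div_nonneg (ha0 e) hτ.le)
    (fun e ↦ (div_le_one hτ).2 (haτ e))
  have hs : p * ∑ e, (a e / τ + (a e / τ) ^ 2) ≤ 2 * k := by
    have : ∑ e, (a e / τ + (a e / τ) ^ 2) ≤ ∑ e, 2 * (a e / τ) := by
      refine Finset.sum_le_sum fun e _ ↦ ?_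
      have g0 := div_nonneg (ha0 e) hτ.le
      have g1 := (div_le_one hτ).2 (haτ e)
      nlinarith
    refine (mul_le_mul_of_nonneg_left this h0).trans ?_
    rw [← Finset.mul_sum, ← Finset.sum_div]
    have e2 : p * (∑ e, a e) / τ ≤ k := by rwa [div_le_iff₀ hτ]
    have e3 : p * (2 * ((∑ e, a e) / τ)) = 2 * (p * (∑ e, a e) / τ) := by ring
    linarith
  calc _ ≤ (τ * k) ^ k * Real.exp k * Real.exp (2 * k) := by
        refine mul_le_mul_of_nonneg_left (hm.trans (Real.exp_le_exp.2 hs)) (by positivity)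
    _ = _ := by
        have : Real.exp k * Real.exp (2 * k) = Real.exp 3 ^ k := by
          rw [← Real.exp_add, ← Real.exp_nat_mul]
          congr 1
          ring
        rw [mul_assoc, this, ← mul_pow]
        congr 1
        ring

open Classical in
/-- A Chernoff bound for the number of observed positions in `s`. -/
theorem cubeExp_chernoff {p : ℝ} (h0 : 0 ≤ p) (h1 : p ≤ 1) (s : Finset ι) :
    cubeExp p (fun x ↦ if 2 * p * s.card < ∑ e ∈ s, coord x e then 1 else 0) ≤
      Real.exp (-(p * s.card / 4)) := by
  -- Exponential tilt `1/2`: the threshold yields exponent `p * s.card`, the generating function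
  -- costs `3/4` of it, and `1/4` remains.
  let a : ι → ℝ := fun e ↦ if e ∈ s then 1 / 2 else 0
  have hsum : ∀ x : ι → Bool, ∑ e, coord x e * a e = (∑ e ∈ s, coord x e) / 2 := by
    intro x
    simp only [a, mul_ite, mul_zero, Finset.sum_ite_mem, Finset.univ_inter, Finset.sum_div]
    exact Finset.sum_congr rfl fun e _ ↦ by ring
  have hm := cubeExp_exp_sum_le h0 h1 a (fun e ↦ by simp only [a]; split_ifs <;> norm_num)
    (fun e ↦ by simp only [a]; split_ifs <;> norm_num)
  have hv : ∑ e, (a e + a e ^ 2) = 3 / 4 * s.card := by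
    have : ∀ e, a e + a e ^ 2 = if e ∈ s then 3 / 4 else 0 := by
      intro e; simp only [a]; split_ifs <;> norm_num
    simp only [this, Finset.sum_ite_mem, Finset.univ_inter, Finset.sum_const, nsmul_eq_mul]
    ring
  have := cubeExp_markov h0 h1 (F := fun x ↦ Real.exp (∑ e, coord x e * a e))
    (fun x ↦ (Real.exp_pos _).le) (t := Real.exp (p * s.card))
    {x | 2 * p * s.card < ∑ e ∈ s, coord x e} (fun x hx ↦ by
      rw [Real.exp_le_exp, hsum]
      have : 2 * p * s.card < ∑ e ∈ s, coord x e := hx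
      linarith)
  have h3 := this.trans hm
  rw [hv, mul_comm, ← le_div_iff₀ (Real.exp_pos _), ← Real.exp_sub] at h3
  refine h3.trans (Real.exp_le_exp.2 ?_)
  linarith

end MomentBound

/-! ### The symmetric dilation of the centered matrix. -/

section Dilation

open Matrix

variable {n : ℕ}

/-- The symmetric dilation of the matrix with the single entry `M i j`. -/
def dilationEntry (M : Matrix (Fin n) (Fin n) ℝ) (e : Fin n × Fin n) :
    Matrix (Fin n ⊕ Fin n) (Fin n ⊕ Fin n) ℝ :=
  M e.1 e.2 • (Matrix.single (Sum.inl e.1) (Sum.inr e.2) 1 +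
    Matrix.single (Sum.inr e.2) (Sum.inl e.1) 1)

theorem dilationEntry_isSymm (M : Matrix (Fin n) (Fin n) ℝ) (e : Fin n × Fin n) :
    (dilationEntry M e).IsSymm := by
  simp only [Matrix.IsSymm, dilationEntry, transpose_smul, transpose_add, transpose_single]
  rw [add_comm]

theorem trace_dilationEntry_sq_mul (M : Matrix (Fin n) (Fin n) ℝ) (e : Fin n × Fin n)
    (G : Matrix (Fin n ⊕ Fin n) (Fin n ⊕ Fin n) ℝ) :
    (dilationEntry M e ^ 2 * G).trace =
      M e.1 e.2 ^ 2 * (G (Sum.inl e.1) (Sum.inl e.1) + G (Sum.inr e.2) (Sum.inr e.2)) := by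
  rw [sq, dilationEntry, smul_mul, Matrix.mul_smul, smul_smul, Matrix.add_mul, Matrix.mul_add,
    Matrix.mul_add, single_mul_single_same, single_mul_single_same,
    single_mul_single_of_ne _ _ _ _ (by simp), single_mul_single_of_ne _ _ _ _ (by simp)]
  simp only [smul_mul, trace_smul, smul_eq_mul, Matrix.add_mul, trace_add, zero_add, add_zero,
    trace_single_mul, mul_one, one_mul, sq]

/-- The centered observed matrix. -/
def centered (p : ℝ) (M : Matrix (Fin n) (Fin n) ℝ) (x : Fin n × Fin n → Bool) :
    Matrix (Fin n) (Fin n) ℝ :=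
  Matrix.of fun i j ↦ (coord x (i, j) - p) * M i j

theorem bernoulliSeries_dilationEntry (p : ℝ) (M : Matrix (Fin n) (Fin n) ℝ)
    (x : Fin n × Fin n → Bool) :
    bernoulliSeries p (dilationEntry M) x =
      fromBlocks 0 (centered p M x) (centered p M x)ᵀ 0 := by
  ext a b
  rw [bernoulliSeries, Matrix.sum_apply, Fintype.sum_prod_type]
  rcases a with i | i <;> rcases b with j | j <;>
    simp [dilationEntry, Matrix.single_apply, centered, ite_and]

/-- The row and column sums of `(x e + p) * M e ^ 2`. -/
def rowColSum (p : ℝ) (M : Matrix (Fin n) (Fin n) ℝ) (x : Fin n × Fin n → Bool) :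
    Fin n ⊕ Fin n → ℝ :=
  Sum.elim (fun i ↦ ∑ j, (coord x (i, j) + p) * M i j ^ 2)
    (fun j ↦ ∑ i, (coord x (i, j) + p) * M i j ^ 2)

theorem rowColSum_nonneg {p : ℝ} (h0 : 0 ≤ p) (M : Matrix (Fin n) (Fin n) ℝ)
    (x : Fin n × Fin n → Bool) (a : Fin n ⊕ Fin n) : 0 ≤ rowColSum p M x a := by
  have : ∀ i j, 0 ≤ (coord x (i, j) + p) * M i j ^ 2 := fun i j ↦ by
    unfold coord; split_ifs <;> positivity
  rcases a with i | j <;> simp only [rowColSum, Sum.elim_inl, Sum.elim_inr]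
  · exact Finset.sum_nonneg fun j _ ↦ this i j
  · exact Finset.sum_nonneg fun i _ ↦ this i j

/-- The square of each dilated entry is diagonal, so the variance term of the Efron–Stein bound sees
only diagonal entries of `G`. -/
theorem sum_trace_dilationEntry (p : ℝ) (M : Matrix (Fin n) (Fin n) ℝ)
    (x : Fin n × Fin n → Bool) (G : Matrix (Fin n ⊕ Fin n) (Fin n ⊕ Fin n) ℝ) :
    ∑ e, (coord x e + p) * (dilationEntry M e ^ 2 * G).trace =
      ∑ a, rowColSum p M x a * G a a := by
  simp only [trace_dilationEntry_sq_mul, Fintype.sum_prod_type, mul_add,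
    Finset.sum_add_distrib, Fintype.sum_sum_type, rowColSum, Sum.elim_inl, Sum.elim_inr,
    Finset.sum_mul]
  congr 1
  · exact Finset.sum_congr rfl fun i _ ↦ Finset.sum_congr rfl fun j _ ↦ by ring
  · rw [Finset.sum_comm]
    exact Finset.sum_congr rfl fun i _ ↦ Finset.sum_congr rfl fun j _ ↦ by ring

/-- With `B` the right side, Efron–Stein gives `E ≤ (N+1) Y` and Young gives `(N+1)² Y ≤ B + N E`.
Hence `(N+1) E ≤ B + N E`, and absorption leaves coefficient one. -/
theorem cubeExp_trace_dilation_le {p : ℝ} (h0 : 0 ≤ p) (h1 : p ≤ 1)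
    (M : Matrix (Fin n) (Fin n) ℝ) (N : ℕ) :
    cubeExp p (fun x ↦ ((bernoulliSeries p (dilationEntry M) x) ^ (2 * (N + 1))).trace) ≤
      ∑ a, cubeExp p (fun x ↦ (((N : ℝ) + 1) * rowColSum p M x a) ^ (N + 1)) := by
  set E := cubeExp p (fun x ↦ ((bernoulliSeries p (dilationEntry M) x) ^ (2 * (N + 1))).trace)
    with hE
  have h2 := cubeExp_trace_pow_le h0 h1 (dilationEntry_isSymm M) N
  simp only [sum_trace_dilationEntry] at h2
  rw [← hE] at h2
  set Y := cubeExp p (fun x ↦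
    ∑ a, rowColSum p M x a * ((bernoulliSeries p (dilationEntry M) x) ^ (2 * N)) a a) with hY
  have h3 : ((N : ℝ) + 1) * (((N : ℝ) + 1) * Y) ≤
      ∑ a, cubeExp p (fun x ↦ (((N : ℝ) + 1) * rowColSum p M x a) ^ (N + 1)) + N * E := by
    rw [hY, hE, ← cubeExp_const_mul, ← cubeExp_const_mul, ← cubeExp_sum, ← cubeExp_const_mul,
      ← cubeExp_add]
    refine cubeExp_mono h0 h1 fun x ↦ ?_
    have := sum_diag_pow_le (bernoulliSeries_isSymm p (dilationEntry_isSymm M) x) N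
      (z := fun a ↦ ((N : ℝ) + 1) * rowColSum p M x a)
      (fun a ↦ mul_nonneg (by positivity) (rowColSum_nonneg h0 M x a))
    simp only [mul_assoc, ← Finset.mul_sum] at this ⊢
    exact this
  have hY0 : 0 ≤ Y := by
    have : cubeExp p (fun _ : Fin n × Fin n → Bool ↦ (0 : ℝ)) ≤ Y :=
      cubeExp_mono h0 h1 fun x ↦ Finset.sum_nonneg fun a _ ↦
        mul_nonneg (rowColSum_nonneg h0 M x a)
          (diag_pow_two_mul_nonneg (bernoulliSeries_isSymm p (dilationEntry_isSymm M) x) N a)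
    simpa [cubeExp] using this
  have h4 : E ≤ ((N : ℝ) + 1) * Y := h2.trans (by nlinarith)
  have h5 := mul_le_mul_of_nonneg_left h4 (show (0 : ℝ) ≤ N + 1 by positivity)
  linarith

theorem cubeExp_rowColSum_pow_le {p : ℝ} (h0 : 0 ≤ p) (h1 : p ≤ 1)
    {M : Matrix (Fin n) (Fin n) ℝ} {τ V : ℝ} (hτ : 0 < τ) (hM : ∀ i j, M i j ^ 2 ≤ τ)
    (hrow : ∀ i, ∑ j, M i j ^ 2 ≤ V) (hcol : ∀ j, ∑ i, M i j ^ 2 ≤ V)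
    {k : ℕ} (hV : p * V ≤ k * τ) (a : Fin n ⊕ Fin n) :
    cubeExp p (fun x ↦ rowColSum p M x a ^ k) ≤ (Real.exp 3 * (k * τ)) ^ k := by
  rcases a with i | j
  · have := cubeExp_sum_pow_le (ι := Fin n × Fin n) h0 h1
      (a := fun e ↦ if e.1 = i then M e.1 e.2 ^ 2 else 0) hτ
      (fun e ↦ by split_ifs <;> positivity)
      (fun e ↦ by split_ifs; exacts [hM _ _, hτ.le]) (k := k)
      (by
        refine le_trans (mul_le_mul_of_nonneg_left ?_ h0) hV
        rw [Fintype.sum_prod_type_right]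
        simpa using hrow i)
    refine le_trans (le_of_eq ?_) this
    congr 1
    ext x
    rw [Fintype.sum_prod_type_right]
    simp [rowColSum]
  · have := cubeExp_sum_pow_le (ι := Fin n × Fin n) h0 h1
      (a := fun e ↦ if e.2 = j then M e.1 e.2 ^ 2 else 0) hτ
      (fun e ↦ by split_ifs <;> positivity)
      (fun e ↦ by split_ifs; exacts [hM _ _, hτ.le]) (k := k)
      (by
        refine le_trans (mul_le_mul_of_nonneg_left ?_ h0) hV
        rw [Fintype.sum_prod_type]
        simpa using hcol j)
    refine le_trans (le_of_eq ?_) this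
    congr 1
    ext x
    rw [Fintype.sum_prod_type]
    simp [rowColSum]

/-- A trace moment bound for the centered observed matrix. -/
theorem cubeExp_trace_dilation_le_pow {p : ℝ} (h0 : 0 ≤ p) (h1 : p ≤ 1)
    {M : Matrix (Fin n) (Fin n) ℝ} {τ V : ℝ} (hτ : 0 < τ) (hM : ∀ i j, M i j ^ 2 ≤ τ)
    (hrow : ∀ i, ∑ j, M i j ^ 2 ≤ V) (hcol : ∀ j, ∑ i, M i j ^ 2 ≤ V)
    {k : ℕ} (hk : k ≠ 0) (hV : p * V ≤ k * τ) :
    cubeExp p (fun x ↦ ((bernoulliSeries p (dilationEntry M) x) ^ (2 * k)).trace) ≤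
      2 * n * (Real.exp 3 * (k ^ 2 * τ)) ^ k := by
  obtain ⟨N, rfl⟩ : ∃ N, k = N + 1 := ⟨k - 1, by omega⟩
  refine (cubeExp_trace_dilation_le h0 h1 M N).trans ?_
  have : ∀ a, cubeExp p (fun x ↦ (((N : ℝ) + 1) * rowColSum p M x a) ^ (N + 1)) ≤
      (Real.exp 3 * (((N + 1 : ℕ) : ℝ) ^ 2 * τ)) ^ (N + 1) := by
    intro a
    simp only [mul_pow (N + 1 : ℝ), cubeExp_const_mul]
    refine (mul_le_mul_of_nonneg_left
      (cubeExp_rowColSum_pow_le h0 h1 hτ hM hrow hcol hV a) (by positivity)).trans (le_of_eq ?_)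
    rw [← mul_pow]
    push_cast
    congr 1
    ring
  refine (Finset.sum_le_sum fun a _ ↦ this a).trans (le_of_eq ?_)
  rw [Finset.sum_const, Finset.card_univ, Fintype.card_sum, Fintype.card_fin, nsmul_eq_mul,
    Nat.cast_add, ← two_mul]

/-- The operator norm of a matrix is bounded by even Schatten norms of its dilation. -/
theorem centered_mulVec_le {p : ℝ} {M : Matrix (Fin n) (Fin n) ℝ} {x : Fin n × Fin n → Bool}
    {k : ℕ} (hk : k ≠ 0) {T : ℝ} (hT : 0 ≤ T)
    (h : ((bernoulliSeries p (dilationEntry M) x) ^ (2 * k)).trace ≤ T ^ k) (z : Fin n → ℝ) :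
    (centered p M x *ᵥ z) ⬝ᵥ (centered p M x *ᵥ z) ≤ T * (z ⬝ᵥ z) := by
  have := mulVec_dotProduct_le_of_trace_pow_le
    (bernoulliSeries_isSymm p (dilationEntry_isSymm M) x) hk hT h (Sum.elim 0 z)
  rw [bernoulliSeries_dilationEntry, fromBlocks_mulVec] at this
  simpa [dotProduct] using this

end Dilation

/-! ### Deterministic low-rank approximation. -/

section LowRankApproximation

variable {n : ℕ}

open Matrix

theorem _root_.OrthonormalBasis.dotProduct_eq
    (b : OrthonormalBasis (Fin n) ℝ (EuclideanSpace ℝ (Fin n))) (i j : Fin n) :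
    (b i).ofLp ⬝ᵥ (b j).ofLp = if i = j then 1 else 0 := by
  rw [← orthonormal_iff_ite.1 b.orthonormal i j]
  simp [PiLp.inner_apply, dotProduct, mul_comm]

theorem _root_.OrthonormalBasis.sum_smul_dotProduct_self
    (b : OrthonormalBasis (Fin n) ℝ (EuclideanSpace ℝ (Fin n))) (c : Fin n → ℝ) :
    (∑ i, c i • (b i).ofLp) ⬝ᵥ (∑ i, c i • (b i).ofLp) = ∑ i, c i ^ 2 := by
  simp only [sum_dotProduct, dotProduct_sum, smul_dotProduct, dotProduct_smul,
    b.dotProduct_eq, smul_eq_mul, mul_ite, mul_one, mul_zero, Finset.sum_ite_eq',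
    Finset.mem_univ, if_true, sq]

theorem _root_.OrthonormalBasis.sum_dotProduct_smul
    (b : OrthonormalBasis (Fin n) ℝ (EuclideanSpace ℝ (Fin n))) (z : Fin n → ℝ) :
    ∑ i, ((b i).ofLp ⬝ᵥ z) • (b i).ofLp = z := by
  have := congrArg WithLp.ofLp (b.sum_repr' (WithLp.toLp 2 z))
  rw [WithLp.ofLp_sum] at this
  conv_rhs => rw [← WithLp.ofLp_toLp 2 z, ← this]
  refine Finset.sum_congr rfl fun i _ ↦ ?_
  rw [WithLp.ofLp_smul]
  congr 1
  simp [PiLp.inner_apply, dotProduct, mul_comm]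

theorem _root_.OrthonormalBasis.sum_dotProduct_sq
    (b : OrthonormalBasis (Fin n) ℝ (EuclideanSpace ℝ (Fin n))) (z : Fin n → ℝ) :
    ∑ i, ((b i).ofLp ⬝ᵥ z) ^ 2 = z ⬝ᵥ z := by
  rw [← b.sum_smul_dotProduct_self, b.sum_dotProduct_smul]

theorem sum_vecMulVec_mulVec (u v : Fin n → Fin n → ℝ) (s : Fin n → ℝ) (z : Fin n → ℝ) :
    (∑ i, s i • vecMulVec (u i) (v i)) *ᵥ z = ∑ i, (s i * (v i ⬝ᵥ z)) • u i := by
  rw [Matrix.sum_mulVec]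
  refine Finset.sum_congr rfl fun i _ ↦ ?_
  rw [smul_mulVec, vecMulVec_mulVec]
  ext a
  simp
  ring

theorem SVD.mulVec_eq {A : Matrix (Fin n) (Fin n) ℝ} (D : SVD A) (z : Fin n → ℝ) :
    A *ᵥ z = ∑ i, (D.σ i * ((D.v i).ofLp ⬝ᵥ z)) • (D.u i).ofLp := by
  conv_lhs => rw [D.eq_sum]
  exact sum_vecMulVec_mulVec (fun i ↦ (D.u i).ofLp) (fun i ↦ (D.v i).ofLp) D.σ z

theorem SVD.proj_eq {A : Matrix (Fin n) (Fin n) ℝ} (D : SVD A) (p : ℝ) (r : ℕ) :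
    D.proj p r = ∑ i, (if i.val < r then 1 / p * D.σ i else 0) •
      vecMulVec (D.u i).ofLp (D.v i).ofLp := by
  rw [SVD.proj, Finset.sum_filter, Finset.smul_sum]
  refine Finset.sum_congr rfl fun i _ ↦ ?_
  split_ifs <;> simp [smul_smul]

/-- Weyl's inequality: the singular values past the rank of `M` are bounded by the
perturbation. -/
theorem SVD.sigma_le {A M : Matrix (Fin n) (Fin n) ℝ} (D : SVD A) {p t : ℝ} (hp : 0 < p)
    (ht : 0 ≤ t)
    (h : ∀ z, (((1 / p) • A - M) *ᵥ z) ⬝ᵥ (((1 / p) • A - M) *ᵥ z) ≤ t ^ 2 * (z ⬝ᵥ z))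
    {i : Fin n} (hi : M.rank ≤ i) : 1 / p * D.σ i ≤ t := by
  classical
  let g : ({j : Fin n // j ≤ i} → ℝ) →ₗ[ℝ] (Fin n → ℝ) :=
    ∑ j : {j : Fin n // j ≤ i}, (LinearMap.proj j).smulRight (D.v j).ofLp
  have hg : ∀ c, g c = ∑ j : {j : Fin n // j ≤ i}, c j • (D.v j).ofLp := by
    intro c; simp [g]
  let f : ({j : Fin n // j ≤ i} → ℝ) →ₗ[ℝ] LinearMap.range M.mulVecLin :=
    M.mulVecLin.rangeRestrict ∘ₗ g
  -- Indices start at `0`, so `v 0, …, v i` span dimension `i + 1`, more than the rank of `M`. Some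
  -- nonzero combination is killed by `M`; on it the perturbation acts as `(1 / p) • A`, which
  -- stretches by at least `1 / p * σ i`.
  have hker : LinearMap.ker f ≠ ⊥ := by
    apply LinearMap.ker_ne_bot_of_finrank_lt
    have h1 : Module.finrank ℝ (LinearMap.range M.mulVecLin) = M.rank := rfl
    have h2 : Fintype.card {j : Fin n // j ≤ i} = i + 1 := by
      rw [Fintype.card_subtype]
      have : (Finset.univ.filter fun j : Fin n ↦ j ≤ i) = Finset.Iic i := by ext; simp
      rw [this, Fin.card_Iic]
    rw [h1, Module.finrank_fintype_fun_eq_card, h2]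
    omega
  obtain ⟨c, hc, hc0⟩ := Submodule.exists_mem_ne_zero_of_ne_bot hker
  have hM : M *ᵥ g c = 0 := by
    have := congrArg Subtype.val (LinearMap.mem_ker.1 hc)
    simpa [f] using this
  let d : Fin n → ℝ := fun j ↦ if hj : j ≤ i then c ⟨j, hj⟩ else 0
  have hd : ∀ j, ¬ j ≤ i → d j = 0 := fun j hj ↦ by simp [d, hj]
  have hgd : g c = ∑ j, d j • (D.v j).ofLp := by
    have h1 : ∑ j, d j • (D.v j).ofLp = ∑ j with j ≤ i, d j • (D.v j).ofLp := by
      rw [Finset.sum_filter]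
      exact Finset.sum_congr rfl fun j _ ↦ by split_ifs with hj <;> simp [hd, hj]
    rw [hg, h1, Finset.sum_subtype (p := fun j ↦ j ≤ i) _ (by simp)]
    exact Finset.sum_congr rfl fun j _ ↦ by simp [d, j.2]
  have hv : ∀ j, (D.v j).ofLp ⬝ᵥ g c = d j := by
    intro j
    simp [hgd, dotProduct_sum, D.v.dotProduct_eq]
  have hz := h (g c)
  have hA : ((1 / p) • A - M) *ᵥ g c = ∑ j, (1 / p * D.σ j * d j) • (D.u j).ofLp := by
    rw [sub_mulVec, hM, sub_zero, smul_mulVec, D.mulVec_eq, Finset.smul_sum]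
    exact Finset.sum_congr rfl fun j _ ↦ by rw [hv, smul_smul, mul_assoc]
  rw [hA, D.u.sum_smul_dotProduct_self, hgd, D.v.sum_smul_dotProduct_self] at hz
  have hpos : 0 < ∑ j, d j ^ 2 := by
    obtain ⟨j, hj⟩ := Function.ne_iff.1 hc0
    refine Finset.sum_pos' (fun j _ ↦ sq_nonneg _) ⟨j, Finset.mem_univ _, ?_⟩
    have : d j = c j := by simp [d, j.2]
    rw [this]
    have : c j ≠ 0 := hj
    positivity
  have hle : (1 / p * D.σ i) ^ 2 * ∑ j, d j ^ 2 ≤ ∑ j, (1 / p * D.σ j * d j) ^ 2 := by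
    rw [Finset.mul_sum]
    refine Finset.sum_le_sum fun j _ ↦ ?_
    by_cases hj : j ≤ i
    · rw [mul_pow (1 / p * D.σ j)]
      refine mul_le_mul_of_nonneg_right (pow_le_pow_left₀ ?_ ?_ 2) (sq_nonneg _)
      · have := D.σ_nonneg i; positivity
      · exact mul_le_mul_of_nonneg_left (D.σ_antitone hj) (by positivity)
    · simp [hd j hj]
  exact le_of_pow_le_pow_left₀ two_ne_zero ht (le_of_mul_le_mul_right (hle.trans hz) hpos)

theorem add_dotProduct_add_le (a b : Fin n → ℝ) :
    (a + b) ⬝ᵥ (a + b) ≤ 2 * (a ⬝ᵥ a) + 2 * (b ⬝ᵥ b) := by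
  simp only [dotProduct, Finset.mul_sum, ← Finset.sum_add_distrib, Pi.add_apply]
  exact Finset.sum_le_sum fun i _ ↦ by nlinarith [sq_nonneg (a i - b i)]

/-- The error is minus the perturbation plus the discarded tail of the decomposition. Each has
operator norm at most `t`, the tail by Weyl's inequality. -/
theorem SVD.sub_proj_mulVec_le {A M : Matrix (Fin n) (Fin n) ℝ} (D : SVD A) {p t : ℝ}
    (hp : 0 < p) (ht : 0 ≤ t)
    (h : ∀ z, (((1 / p) • A - M) *ᵥ z) ⬝ᵥ (((1 / p) • A - M) *ᵥ z) ≤ t ^ 2 * (z ⬝ᵥ z))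
    (z : Fin n → ℝ) :
    ((M - D.proj p M.rank) *ᵥ z) ⬝ᵥ ((M - D.proj p M.rank) *ᵥ z) ≤
      4 * t ^ 2 * (z ⬝ᵥ z) := by
  let w : Fin n → ℝ := fun i ↦
    (if i.val < M.rank then 0 else 1 / p * D.σ i) * ((D.v i).ofLp ⬝ᵥ z)
  have e : (M - D.proj p M.rank) *ᵥ z =
      -(((1 / p) • A - M) *ᵥ z) + ∑ i, w i • (D.u i).ofLp := by
    rw [D.proj_eq, sub_mulVec, sub_mulVec,
      sum_vecMulVec_mulVec (fun i ↦ (D.u i).ofLp) (fun i ↦ (D.v i).ofLp), smul_mulVec,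
      D.mulVec_eq, Finset.smul_sum, neg_sub, sub_add, ← Finset.sum_sub_distrib]
    congr 1
    refine Finset.sum_congr rfl fun i _ ↦ ?_
    simp only [w]
    split_ifs <;> simp [smul_smul, mul_assoc]
  have h2 : (∑ i, w i • (D.u i).ofLp) ⬝ᵥ (∑ i, w i • (D.u i).ofLp) ≤ t ^ 2 * (z ⬝ᵥ z) := by
    rw [D.u.sum_smul_dotProduct_self, ← D.v.sum_dotProduct_sq z, Finset.mul_sum]
    refine Finset.sum_le_sum fun i _ ↦ ?_
    simp only [w]
    rw [mul_pow]
    refine mul_le_mul_of_nonneg_right ?_ (sq_nonneg _)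
    split_ifs with hi
    · simpa using sq_nonneg t
    · refine pow_le_pow_left₀ ?_ (D.sigma_le hp ht h (not_lt.1 hi)) 2
      have := D.σ_nonneg i
      positivity
  rw [e]
  refine (add_dotProduct_add_le _ _).trans ?_
  rw [neg_dotProduct_neg]
  linarith [h z]

theorem rank_add_le (A B : Matrix (Fin n) (Fin n) ℝ) : (A + B).rank ≤ A.rank + B.rank := by
  refine le_trans (Submodule.finrank_mono ?_) (Submodule.finrank_add_le_finrank_add_finrank
    (LinearMap.range A.mulVecLin) (LinearMap.range B.mulVecLin))
  rintro _ ⟨z, rfl⟩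
  rw [mulVecLin_add, LinearMap.add_apply]
  exact Submodule.add_mem_sup ⟨z, rfl⟩ ⟨z, rfl⟩

theorem rank_sum_vecMulVec_le {κ : Type*} (s : Finset κ) (u v : κ → Fin n → ℝ) (c : κ → ℝ) :
    (∑ i ∈ s, c i • vecMulVec (u i) (v i)).rank ≤ s.card := by
  classical
  induction s using Finset.induction_on with
  | empty => simp
  | insert a s ha ih =>
    rw [Finset.sum_insert ha, Finset.card_insert_of_notMem ha, add_comm]
    refine (rank_add_le _ _).trans (add_le_add ih ?_)
    rw [← smul_vecMulVec]
    exact rank_vecMulVec_le _ _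

theorem SVD.rank_proj_le {A : Matrix (Fin n) (Fin n) ℝ} (D : SVD A) (p : ℝ) (r : ℕ) :
    (D.proj p r).rank ≤ r := by
  rw [SVD.proj, Finset.smul_sum]
  simp only [smul_smul]
  refine (rank_sum_vecMulVec_le _ (fun i ↦ (D.u i).ofLp) (fun i ↦ (D.v i).ofLp)
    (fun i ↦ 1 / p * D.σ i)).trans ?_
  have : (Finset.univ.filter fun i : Fin n ↦ i.val < r).card ≤ (Finset.range r).card :=
    Finset.card_le_card_of_injOn Fin.val (fun i hi ↦ by simpa using hi)
      (fun i _ j _ hij ↦ Fin.ext hij)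
  simpa using this

/-- The squared Frobenius norm is at most the rank times the squared operator norm. -/
theorem sum_sq_le_rank_mul {Z : Matrix (Fin n) (Fin n) ℝ} {s : ℝ}
    (h : ∀ z, (Z *ᵥ z) ⬝ᵥ (Z *ᵥ z) ≤ s * (z ⬝ᵥ z)) :
    ∑ i, ∑ j, Z i j ^ 2 ≤ Z.rank * s := by
  have hH : (Zᵀ * Z).IsHermitian := by
    rw [Matrix.IsHermitian, conjTranspose_eq_transpose_of_trivial, transpose_mul,
      transpose_transpose]
  have h1 : ∑ i, ∑ j, Z i j ^ 2 = (Zᵀ * Z).trace := by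
    simp only [trace, diag_apply, Matrix.mul_apply, transpose_apply]
    rw [Finset.sum_comm]
    exact Finset.sum_congr rfl fun i _ ↦ Finset.sum_congr rfl fun j _ ↦ by ring
  have h2 : (Zᵀ * Z).trace = ∑ i, hH.eigenvalues i := by
    simpa using hH.trace_eq_sum_eigenvalues
  have h3 : ∀ i, hH.eigenvalues i ≤ s := by
    intro i
    have hb := hH.eigenvectorBasis.dotProduct_eq i i
    have := h (hH.eigenvectorBasis i).ofLp
    rw [dotProduct_mulVec, ← mulVec_transpose, mulVec_mulVec, hH.mulVec_eigenvectorBasis,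
      smul_dotProduct, hb] at this
    simpa using this
  have h4 : Fintype.card {i // hH.eigenvalues i ≠ 0} = Z.rank := by
    rw [← hH.rank_eq_card_non_zero_eigs, rank_transpose_mul_self]
  rw [h1, h2, ← h4, Fintype.card_subtype, ← nsmul_eq_mul, ← Finset.sum_filter_ne_zero]
  exact Finset.sum_le_card_nsmul _ _ _ fun i _ ↦ h3 i

/-- The error has rank at most `2 * M.rank` and squared operator norm at most `4 * t ^ 2`; the
resulting factor `8` is rounded up to `9 = 3 ^ 2`. -/
theorem SVD.frobNorm_sub_proj_le {A M : Matrix (Fin n) (Fin n) ℝ} (D : SVD A) {p t : ℝ}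
    (hp : 0 < p) (ht : 0 ≤ t)
    (h : ∀ z, (((1 / p) • A - M) *ᵥ z) ⬝ᵥ (((1 / p) • A - M) *ᵥ z) ≤ t ^ 2 * (z ⬝ᵥ z)) :
    frobNorm (M - D.proj p M.rank) ≤ 3 * √M.rank * t := by
  have h1 := sum_sq_le_rank_mul (D.sub_proj_mulVec_le hp ht h)
  have h2 : ((M - D.proj p M.rank).rank : ℝ) ≤ 2 * M.rank := by
    have h3 : (M - D.proj p M.rank).rank ≤ M.rank + (D.proj p M.rank).rank := by
      rw [sub_eq_add_neg]
      refine (rank_add_le _ _).trans (add_le_add le_rfl ?_)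
      have := rank_mul_le_right (-1 : Matrix (Fin n) (Fin n) ℝ) (D.proj p M.rank)
      rwa [neg_one_mul] at this
    have h4 := D.rank_proj_le p M.rank
    have : (M - D.proj p M.rank).rank ≤ 2 * M.rank := by omega
    exact_mod_cast this
  rw [frobNorm]
  apply Real.sqrt_le_iff.2 ⟨by positivity, ?_⟩
  refine h1.trans ?_
  rw [mul_pow, mul_pow, Real.sq_sqrt (by positivity)]
  nlinarith [sq_nonneg t, mul_le_mul_of_nonneg_right h2 (sq_nonneg t),
    mul_nonneg (Nat.cast_nonneg (α := ℝ) M.rank) (sq_nonneg t)]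

end LowRankApproximation

/-! ### The good event and the choice of parameters. -/

section Recovery

open Matrix

variable {n : ℕ}

theorem abs_le_maxNorm (M : Matrix (Fin n) (Fin n) ℝ) (i j : Fin n) : |M i j| ≤ maxNorm M :=
  (le_ciSup (f := fun j ↦ |M i j|) (Set.finite_range _).bddAbove j).trans
    (le_ciSup (f := fun i ↦ ⨆ j, |M i j|) (Set.finite_range _).bddAbove i)

theorem maxNorm_pos {M : Matrix (Fin n) (Fin n) ℝ} (hM : M ≠ 0) : 0 < maxNorm M := by
  by_contra h
  refine hM (Matrix.ext fun i j ↦ ?_)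
  exact abs_nonpos_iff.1 ((abs_le_maxNorm M i j).trans (not_lt.1 h))

theorem maxRowColNorm_nonneg (M : Matrix (Fin n) (Fin n) ℝ) : 0 ≤ maxRowColNorm M :=
  le_max_of_le_left (Real.iSup_nonneg fun _ ↦ Real.sqrt_nonneg _)

theorem row_sum_sq_le (M : Matrix (Fin n) (Fin n) ℝ) (i : Fin n) :
    ∑ j, M i j ^ 2 ≤ maxRowColNorm M ^ 2 := by
  have h : √(∑ j, M i j ^ 2) ≤ maxRowColNorm M :=
    (le_ciSup (f := fun i ↦ √(∑ b, M i b ^ 2)) (Set.finite_range _).bddAbove i).trans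
      (le_max_left _ _)
  exact (Real.sqrt_le_left (maxRowColNorm_nonneg M)).1 h

theorem col_sum_sq_le (M : Matrix (Fin n) (Fin n) ℝ) (j : Fin n) :
    ∑ i, M i j ^ 2 ≤ maxRowColNorm M ^ 2 := by
  have h : √(∑ i, M i j ^ 2) ≤ maxRowColNorm M :=
    (le_ciSup (f := fun j ↦ √(∑ a, M a j ^ 2)) (Set.finite_range _).bddAbove j).trans
      (le_max_right _ _)
  exact (Real.sqrt_le_left (maxRowColNorm_nonneg M)).1 h

/-- Only an inequality, since an observed entry of `M` may itself vanish. -/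
theorem rowDegree_observe_le (M : Matrix (Fin n) (Fin n) ℝ) (x : Fin n × Fin n → Bool)
    (i : Fin n) :
    (rowDegree (observe {e | x e = true} M) i : ℝ) ≤
      ∑ e ∈ ({i} : Finset (Fin n)) ×ˢ Finset.univ, coord x e := by
  classical
  rw [Finset.sum_product, Finset.sum_singleton, rowDegree]
  simp only [coord]
  rw [Finset.sum_boole, Nat.cast_le]
  refine Finset.card_le_card fun j hj ↦ ?_
  simp only [Finset.mem_filter, observe, Matrix.of_apply, Set.mem_ofPred_eq] at hj ⊢
  exact ⟨Finset.mem_univ _, by by_contra h; simp [h] at hj⟩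

theorem colDegree_observe_le (M : Matrix (Fin n) (Fin n) ℝ) (x : Fin n × Fin n → Bool)
    (j : Fin n) :
    (colDegree (observe {e | x e = true} M) j : ℝ) ≤
      ∑ e ∈ Finset.univ ×ˢ ({j} : Finset (Fin n)), coord x e := by
  classical
  rw [Finset.sum_product_right, Finset.sum_singleton, colDegree]
  simp only [coord]
  rw [Finset.sum_boole, Nat.cast_le]
  refine Finset.card_le_card fun i hi ↦ ?_
  simp only [Finset.mem_filter, observe, Matrix.of_apply, Set.mem_ofPred_eq] at hi ⊢
  exact ⟨Finset.mem_univ _, by by_contra h; simp [h] at hi⟩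

theorem trim_eq_self {p : ℝ} {A : Matrix (Fin n) (Fin n) ℝ}
    (hrow : ∀ i, (rowDegree A i : ℝ) ≤ 2 * p * n)
    (hcol : ∀ j, (colDegree A j : ℝ) ≤ 2 * p * n) : trim p A = A := by
  ext i j
  rw [trim, Matrix.of_apply, if_neg]
  exact not_or.2 ⟨not_lt.2 (hrow i), not_lt.2 (hcol j)⟩

theorem observe_sub_eq_centered {p : ℝ} (hp : p ≠ 0) (M : Matrix (Fin n) (Fin n) ℝ)
    (x : Fin n × Fin n → Bool) :
    (1 / p) • observe {e | x e = true} M - M = (1 / p) • centered p M x := by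
  ext i j
  simp only [observe, centered, coord, Matrix.sub_apply, Matrix.smul_apply, Matrix.of_apply,
    Set.mem_ofPred_eq, smul_eq_mul]
  split_ifs
  · field_simp
  · field_simp
    ring

/-- On the event that no degree is too large and that the trace moment is under control, the
projection is close to `M`. -/
theorem frobNorm_sub_proj_le_of_good {p : ℝ} (hp : 0 < p) {M : Matrix (Fin n) (Fin n) ℝ}
    {x : Fin n × Fin n → Bool} {k : ℕ} (hk : k ≠ 0) {T : ℝ} (hT : 0 ≤ T)
    (htr : ((bernoulliSeries p (dilationEntry M) x) ^ (2 * k)).trace ≤ T ^ k)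
    (hrow : ∀ i : Fin n,
      ∑ e ∈ ({i} : Finset (Fin n)) ×ˢ Finset.univ, coord x e ≤ 2 * p * n)
    (hcol : ∀ j : Fin n,
      ∑ e ∈ Finset.univ ×ˢ ({j} : Finset (Fin n)), coord x e ≤ 2 * p * n)
    (D : SVD (trim p (observe {e | x e = true} M))) :
    frobNorm (M - D.proj p M.rank) ≤ 3 * √M.rank * (√T / p) := by
  refine D.frobNorm_sub_proj_le hp (by positivity) fun z ↦ ?_
  rw [trim_eq_self (fun i ↦ (rowDegree_observe_le M x i).trans (hrow i))
    (fun j ↦ (colDegree_observe_le M x j).trans (hcol j)), observe_sub_eq_centered hp.ne',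
    smul_mulVec, smul_dotProduct, dotProduct_smul, div_pow, Real.sq_sqrt hT, smul_eq_mul,
    smul_eq_mul]
  have := mul_le_mul_of_nonneg_left (centered_mulVec_le hk hT htr z)
    (show 0 ≤ 1 / p * (1 / p) by positivity)
  calc _ = 1 / p * (1 / p) * ((centered p M x *ᵥ z) ⬝ᵥ (centered p M x *ᵥ z)) := by ring
    _ ≤ _ := this
    _ = _ := by field_simp

theorem sqrt_trace_scale_le {l p L V : ℝ} {k : ℕ} (hl : 0 ≤ l) (hp : 0 ≤ p) (hL : 0 ≤ L)
    (hV : 0 ≤ V) (hk0 : k ≠ 0) (hk : (k : ℝ) ≤ 3 * l) :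
    √(Real.exp 2 * (Real.exp 3 * (k ^ 2 * (L ^ 2 + p * V ^ 2 / k)))) ≤
      3 * Real.exp 3 * (l * L + √(p * l) * V) := by
  have hk' : (k : ℝ) ≠ 0 := by exact_mod_cast hk0
  apply Real.sqrt_le_iff.2 ⟨by positivity, ?_⟩
  have e1 : Real.exp 2 * (Real.exp 3 * (k ^ 2 * (L ^ 2 + p * V ^ 2 / k))) =
      Real.exp 5 * (k ^ 2 * L ^ 2 + k * (p * V ^ 2)) := by
    rw [← mul_assoc, ← Real.exp_add]
    norm_num
    field_simp
  have e2 : (3 * Real.exp 3 * (l * L + √(p * l) * V)) ^ 2 =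
      Real.exp 6 * (9 * (l * L + √(p * l) * V) ^ 2) := by
    rw [mul_pow, mul_pow, ← Real.exp_nat_mul]
    norm_num
    ring
  rw [e1, e2]
  refine mul_le_mul (Real.exp_le_exp.2 (by norm_num)) ?_ (by positivity) (by positivity)
  have h1 : (k : ℝ) ^ 2 * L ^ 2 ≤ (3 * l) ^ 2 * L ^ 2 := by gcongr
  have h2 : (k : ℝ) * (p * V ^ 2) ≤ 3 * l * (p * V ^ 2) := by gcongr
  have h3 : (√(p * l) * V) ^ 2 = p * l * V ^ 2 := by rw [mul_pow, Real.sq_sqrt (by positivity)]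
  have h4 : 0 ≤ (l * L) * (√(p * l) * V) := by positivity
  have h5 : 0 ≤ p * l * V ^ 2 := by positivity
  nlinarith

open Classical in
/-- A tail bound for the trace moments of the dilated centered observation. -/
theorem cubeExp_trace_tail {p : ℝ} (h0 : 0 ≤ p) (h1 : p ≤ 1)
    {M : Matrix (Fin n) (Fin n) ℝ} (hM : M ≠ 0) {k : ℕ} (hk : k ≠ 0) {T : ℝ}
    (hT : T = Real.exp 2 * (Real.exp 3 *
      (k ^ 2 * (maxNorm M ^ 2 + p * maxRowColNorm M ^ 2 / k)))) :
    cubeExp p (fun x ↦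
      if T ^ k < ((bernoulliSeries p (dilationEntry M) x) ^ (2 * k)).trace then 1 else 0) ≤
      2 * n * Real.exp (-(2 * k)) := by
  have hL := maxNorm_pos hM
  have hV := maxRowColNorm_nonneg M
  have hk' : (0 : ℝ) < k := by exact_mod_cast Nat.pos_of_ne_zero hk
  -- The first summand dominates every `M i j ^ 2`, the second ensures `p * V ≤ k * τ` with `V =
  -- maxRowColNorm M ^ 2`. The extra `exp 2` in `T` produces the decay `exp (-(2 * k))` in Markov's
  -- inequality.
  set τ := maxNorm M ^ 2 + p * maxRowColNorm M ^ 2 / k with hτ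
  have hτ0 : 0 < τ := by positivity
  have hQ : 0 < Real.exp 3 * (k ^ 2 * τ) := by positivity
  have hmom := cubeExp_trace_dilation_le_pow h0 h1 (M := M) (V := maxRowColNorm M ^ 2) hτ0
    (fun i j ↦ by
      have := pow_le_pow_left₀ (abs_nonneg _) (abs_le_maxNorm M i j) 2
      rw [sq_abs] at this
      have : 0 ≤ p * maxRowColNorm M ^ 2 / k := by positivity
      linarith)
    (row_sum_sq_le M) (col_sum_sq_le M) hk (by
      have : (k : ℝ) * (p * maxRowColNorm M ^ 2 / k) = p * maxRowColNorm M ^ 2 := by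
        field_simp
      have : 0 ≤ k * maxNorm M ^ 2 := by positivity
      rw [hτ, mul_add]
      linarith)
  have hmk := (cubeExp_markov h0 h1
    (F := fun x ↦ ((bernoulliSeries p (dilationEntry M) x) ^ (2 * k)).trace)
    (fun x ↦ trace_pow_two_mul_nonneg (bernoulliSeries_isSymm p (dilationEntry_isSymm M) x) k)
    (t := T ^ k) {x | T ^ k < ((bernoulliSeries p (dilationEntry M) x) ^ (2 * k)).trace}
    (fun x hx ↦ le_of_lt hx)).trans hmom
  have hT0 : 0 < T := by rw [hT]; positivity
  rw [mul_comm, ← le_div_iff₀ (pow_pos hT0 k)] at hmk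
  refine hmk.trans (le_of_eq ?_)
  rw [hT, mul_pow (Real.exp 2), mul_div_mul_right _ _ (by positivity), Real.exp_neg, ← Real.exp_nat_mul, mul_comm (k : ℝ),
    div_eq_mul_inv]

theorem recovery_bound {r : ℕ} {M : Matrix (Fin n) (Fin n) ℝ} (hn : 2 ≤ n) (hM : M ≠ 0)
    (hr : M.rank = r) {p : ℝ} (hp0 : 0 < p) (hp1 : p ≤ 1) (hp : 8 * (Real.log n / n) ≤ p)
    {S : Type*} [MeasurableSpace S] (P : Measure S) [IsProbabilityMeasure P]
    (Om : S → Set (Fin n × Fin n)) (hOm : IsBernoulliSample P p Om) :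
    1 - 4 / (n : ℝ) ≤ P.real {ω | ∀ D : SVD (trim p (observe (Om ω) M)),
      frobNorm (M - D.proj p r) ≤ 9 * Real.exp 3 * (√r * Real.log n / p * maxNorm M +
        √(r * Real.log n / p) * maxRowColNorm M)} := by
  classical
  subst hr
  set l := Real.log n with hl
  have hn0 : (0 : ℝ) < n := by positivity
  -- Ensures `⌈l⌉₊ ≤ l + 1 ≤ 3 * l`; this is where `2 ≤ n` matters.
  have hl2 : 1 / 2 ≤ l := by
    have : Real.log 2 ≤ l := Real.log_le_log (by norm_num) (by exact_mod_cast hn)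
    have := Real.log_two_gt_d9
    linarith
  let k := ⌈l⌉₊
  have hk0 : k ≠ 0 := (Nat.ceil_pos.2 (by linarith)).ne'
  have hkl : l ≤ k := Nat.le_ceil l
  have hk3 : (k : ℝ) ≤ 3 * l := by
    have := Nat.ceil_lt_add_one (show 0 ≤ l by linarith)
    linarith
  have hL := (maxNorm_pos hM).le
  have hV := maxRowColNorm_nonneg M
  obtain ⟨T, hT⟩ : ∃ T, T = Real.exp 2 * (Real.exp 3 *
      (k ^ 2 * (maxNorm M ^ 2 + p * maxRowColNorm M ^ 2 / k))) := ⟨_, rfl⟩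
  have hT0 : 0 ≤ T := by rw [hT]; positivity
  have hsqrt : √T ≤ 3 * Real.exp 3 * (l * maxNorm M + √(p * l) * maxRowColNorm M) := by
    rw [hT]
    exact sqrt_trace_scale_le (by linarith) hp0.le hL hV hk0 hk3
  refine le_trans ?_ (hOm.prob_ge fun Ω ↦ ∀ D : SVD (trim p (observe Ω M)),
      frobNorm (M - D.proj p M.rank) ≤ 9 * Real.exp 3 *
        (√M.rank * l / p * maxNorm M + √(M.rank * l / p) * maxRowColNorm M))
  have hexp2 : Real.exp (-(2 * l)) = 1 / (n : ℝ) ^ 2 := by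
    rw [Real.exp_neg, mul_comm, Real.exp_mul, hl, Real.exp_log hn0]
    norm_num
  -- The constant `8` makes each Chernoff failure at most `n ^ (-2)`. The `2n` lines then cost `2 /
  -- n`, and the trace tail another `2 / n`.
  have hpn : 2 * l ≤ p * n / 4 := by
    have := mul_le_mul_of_nonneg_right hp hn0.le
    rw [mul_assoc, div_mul_cancel₀ _ hn0.ne'] at this
    linarith
  let bt : (Fin n × Fin n → Bool) → ℝ := fun x ↦
    if T ^ k < ((bernoulliSeries p (dilationEntry M) x) ^ (2 * k)).trace then 1 else 0
  let bd : Finset (Fin n × Fin n) → (Fin n × Fin n → Bool) → ℝ := fun s x ↦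
    if 2 * p * s.card < ∑ e ∈ s, coord x e then 1 else 0
  have hbt0 : ∀ x, 0 ≤ bt x := fun x ↦ by simp only [bt]; split_ifs <;> norm_num
  have hbd0 : ∀ s x, 0 ≤ bd s x := fun s x ↦ by simp only [bd]; split_ifs <;> norm_num
  have hEt : cubeExp p bt ≤ 2 / n := by
    refine (cubeExp_trace_tail hp0.le hp1 hM hk0 hT).trans ?_
    have : Real.exp (-(2 * k)) ≤ 1 / (n : ℝ) ^ 2 := by
      rw [← hexp2, Real.exp_le_exp]; linarith
    refine (mul_le_mul_of_nonneg_left this (by positivity)).trans (le_of_eq ?_)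
    field_simp
  have hEd : ∀ s : Finset (Fin n × Fin n), s.card = n → cubeExp p (bd s) ≤ 1 / (n : ℝ) ^ 2 := by
    intro s hs
    refine (cubeExp_chernoff hp0.le hp1 s).trans ?_
    rw [← hexp2, Real.exp_le_exp, hs]
    linarith
  have hcr : ∀ i : Fin n, (({i} : Finset (Fin n)) ×ˢ (Finset.univ : Finset (Fin n))).card = n :=
    fun i ↦ by simp
  have hcc : ∀ j : Fin n, ((Finset.univ : Finset (Fin n)) ×ˢ ({j} : Finset (Fin n))).card = n :=
    fun j ↦ by simp
  have hEr : ∑ i : Fin n, cubeExp p (bd ({i} ×ˢ Finset.univ)) ≤ 1 / n := by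
    refine (Finset.sum_le_sum fun i _ ↦ hEd _ (hcr i)).trans (le_of_eq ?_)
    rw [Finset.sum_const, Finset.card_fin, nsmul_eq_mul]
    field_simp
  have hEc : ∑ j : Fin n, cubeExp p (bd (Finset.univ ×ˢ {j})) ≤ 1 / n := by
    refine (Finset.sum_le_sum fun j _ ↦ hEd _ (hcc j)).trans (le_of_eq ?_)
    rw [Finset.sum_const, Finset.card_fin, nsmul_eq_mul]
    field_simp
  -- Union bound in pointwise form: the success indicator is at least one minus the sum of the
  -- failure indicators.
  refine le_trans ?_ (cubeExp_mono hp0.le hp1 (F := fun x ↦ 1 - (bt x +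
    (∑ i : Fin n, bd ({i} ×ˢ Finset.univ) x + ∑ j : Fin n, bd (Finset.univ ×ˢ {j}) x)))
    fun x ↦ ?_)
  · rw [cubeExp_sub, cubeExp_add, cubeExp_add, cubeExp_sum, cubeExp_sum, cubeExp_one]
    have : 4 / (n : ℝ) = 2 / n + (1 / n + 1 / n) := by ring
    linarith
  · have hr0 : 0 ≤ ∑ i : Fin n, bd ({i} ×ˢ Finset.univ) x := Finset.sum_nonneg fun i _ ↦ hbd0 _ x
    have hc0 : 0 ≤ ∑ j : Fin n, bd (Finset.univ ×ˢ {j}) x := Finset.sum_nonneg fun j _ ↦ hbd0 _ x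
    split_ifs with hQ
    · linarith [hbt0 x]
    rw [sub_nonpos]
    by_contra hlt
    rw [not_le] at hlt
    have hgt : ((bernoulliSeries p (dilationEntry M) x) ^ (2 * k)).trace ≤ T ^ k := by
      by_contra h
      have : bt x = 1 := if_pos (not_le.1 h)
      linarith
    have hgr : ∀ i : Fin n,
        ∑ e ∈ ({i} : Finset (Fin n)) ×ˢ Finset.univ, coord x e ≤ 2 * p * n := by
      intro i
      by_contra h
      have h1 : bd ({i} ×ˢ Finset.univ) x = 1 := if_pos (by rw [hcr]; exact not_le.1 h)
      have := Finset.single_le_sum (f := fun i : Fin n ↦ bd ({i} ×ˢ Finset.univ) x)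
        (fun i _ ↦ hbd0 _ x) (Finset.mem_univ i)
      linarith [hbt0 x]
    have hgc : ∀ j : Fin n,
        ∑ e ∈ Finset.univ ×ˢ ({j} : Finset (Fin n)), coord x e ≤ 2 * p * n := by
      intro j
      by_contra h
      have h1 : bd (Finset.univ ×ˢ {j}) x = 1 := if_pos (by rw [hcc]; exact not_le.1 h)
      have := Finset.single_le_sum (f := fun j : Fin n ↦ bd (Finset.univ ×ˢ {j}) x)
        (fun j _ ↦ hbd0 _ x) (Finset.mem_univ j)
      linarith [hbt0 x]
    refine hQ fun D ↦ ?_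
    refine (frobNorm_sub_proj_le_of_good hp0 hk0 hT0 hgt hgr hgc D).trans ?_
    have e1 : √(M.rank * l / p) = √M.rank * (√(p * l) / p) := by
      rw [mul_div_assoc, Real.sqrt_mul (by positivity)]
      congr 1
      rw [eq_div_iff hp0.ne', show p * l = p ^ 2 * (l / p) by field_simp,
        Real.sqrt_mul (by positivity), Real.sqrt_sq hp0.le, mul_comm]
    rw [e1]
    calc 3 * √M.rank * (√T / p)
        ≤ 3 * √M.rank *
          (3 * Real.exp 3 * (l * maxNorm M + √(p * l) * maxRowColNorm M) / p) := by gcongr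
      _ = _ := by ring

end Recovery

end SVDProjection

end

theorem corollary1 :
    ∃ c₀ > (0 : ℝ), ∃ c' > (0 : ℝ), ∃ c₁ > (0 : ℝ), ∃ c₂ > (0 : ℝ),
      ∀ (n : ℕ), 1 ≤ n →
      ∀ (r : ℕ) (M : Matrix (Fin n) (Fin n) ℝ), M.rank = r →
      ∀ (p : ℝ), 0 < p → p ≤ 1 → c₀ * (Real.log n / n) ≤ p →
      ∀ (S : Type*) [MeasurableSpace S] (P : MeasureTheory.Measure S)
        [MeasureTheory.IsProbabilityMeasure P] (Om : S → Set (Fin n × Fin n)),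
        SVDProjection.IsBernoulliSample P p Om →
        1 - c₁ * (n : ℝ) ^ (-c₂) ≤
          P.real {ω | ∀ D : SVDProjection.SVD
              (SVDProjection.trim p (SVDProjection.observe (Om ω) M)),
            SVDProjection.frobNorm (M - D.proj p r) ≤
              c' * (√r * Real.log n / p * SVDProjection.maxNorm M +
                √(r * Real.log n / p) * SVDProjection.maxRowColNorm M)} := by
  refine ⟨8, by norm_num, 9 * Real.exp 3, by positivity, 4, by norm_num, 1, by norm_num, ?_⟩
  intro n hn r M hr p hp0 hp1 hp S _ P _ Om hOm
  rw [Real.rpow_neg_one, ← div_eq_mul_inv]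
  -- For `n = 1` the logarithm vanishes and the error bound can fail, but the claimed probability `1
  -- - 4` is negative.
  obtain rfl | hn2 : n = 1 ∨ 2 ≤ n := by omega
  · have : 0 ≤ P.real {ω | ∀ D : SVDProjection.SVD
              (SVDProjection.trim p (SVDProjection.observe (Om ω) M)),
            SVDProjection.frobNorm (M - D.proj p r) ≤
              9 * Real.exp 3 * (√r * Real.log (1 : ℕ) / p * SVDProjection.maxNorm M +
                √(r * Real.log (1 : ℕ) / p) * SVDProjection.maxRowColNorm M)} :=
      MeasureTheory.measureReal_nonneg
    refine le_trans ?_ this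
    norm_num
  -- The scale `τ` must be positive, so `M = 0` is separated; there both sides of the error bound
  -- are zero.
  by_cases hM : M = 0
  · subst hM
    rw [Matrix.rank_zero] at hr
    subst hr
    have : (0 : ℝ) ≤ 4 / n := by positivity
    simpa [SVDProjection.SVD.proj, SVDProjection.frobNorm] using this
  · exact SVDProjection.recovery_bound hn2 hM hr hp0 hp1 hp P Om hOm
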